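/- Notation. $\mathbb D$ is the open unit disc, $\mathbb T$ the unit circle, $\mathbf m_2$ planar Lebesgue measure. For a closed set $\mathfrak F\subset\mathbb C$, $\mathrm{CL}(\mathfrak F)$ is the set of continuous functions $g:\mathfrak F\to\mathbb C$ for which there is a constant $C\ge 0$ with $\|g(N)R-Rg(N)\|\le C\|NR-RN\|$ for all bounded operators $R$ and all bounded normal operators $N$ with spectrum in $\mathfrak F$ on a complex Hilbert space; $\|g\|_{\mathrm{CL}(\mathfrak F)}$ is the least such $C$. Write $\mathrm{CL}(\mathbb D)=\mathrm{CL}(\operatorname{clos}\mathbb D)$. Let $(\mathrm{CL})'(\mathbb D)=\{g' : g\in \mathrm{CL}(\mathbb D)\}$, where $g'$ is the complex derivative of $g$, which exists at every point of $\operatorname{clos}\mathbb D$ (taken within $\operatorname{clos}\mathbb D$), so that elements of $(\mathrm{CL})'(\mathbb D)$ are functions on $\operatorname{clos}\mathbb D$; put $\|g'\|_{(\mathrm{CL})'(\mathbb D)}=\|g\|_{\mathrm{CL}(\mathbb D)}$. Let $\mathcal{PM}(\mathbb D)$ be the space of complex harmonic functions $u$ in $\mathbb D$ with $\|u\|_{\mathcal{PM}(\mathbb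 D)}=\sup_{0\le r<1}\int_{\mathbb T}|u(r\zeta)|\,|d\zeta|<\infty$. A positive measure $\mu$ on $\mathbb D$ is a Carleson measure in the strong sense if $\int_{\mathbb D}|u|\,d\mu<\infty$ for every $u\in\mathcal{PM}(\mathbb D)$. A complex Radon measure $\mu$ on $\mathbb D$ belongs to $\mathrm{CM}_s(\mathbb D)$ if $|\mu|$ is a Carleson measure in the strong sense, and then $\|\mu\|_{\mathrm{CM}_s(\mathbb D)}=\sup\{\int_{\mathbb D}|u|\,d|\mu| : u\in\mathcal{PM}(\mathbb D),\ \|u\|_{\mathcal{PM}(\mathbb D)}\le 1\}$. Theorem. Let $f$ be analytic in $\mathbb D$ and suppose that $\zeta^{-1}f'(\zeta)\,d\mathbf m_2(\zeta)\in \mathrm{CM}_s(\mathbb D)$. Then $f$ has a finite nontangential boundary value at every point of $\mathbb T$; the function on $\operatorname{clos}\mathbb D$ obtained by extending $f$ by these boundary values, denoted again by $f$, belongs to $(\mathrm{CL})'(\mathbb D)$; and $$\|f-f(0)\|_{(\mathrm{CL})'(\mathbb D)}\le 2\,\bigl\|\zeta^{-1}f'(\zeta)\,d\mathbf m_2(\zeta)\bigr\|_{\mathrm{CM}_s(\mathbb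 D)}.$$ -/

import Mathlib

open MeasureTheory Metric Set Filter Topology
open scoped ENNReal NNReal

universe u

noncomputable section

/-! ### Commutator Lipschitz functions -/

/-- `‖f(N) R - R f(N)‖ ≤ C ‖N R - R N‖` for every bounded operator `R` and every bounded normal
operator `N` with spectrum in `F`, on every complex Hilbert space (of the universe `u`). Here `f(N)`
is the continuous functional calculus. -/
def CommutatorBound (F : Set ℂ) (f : ℂ → ℂ) (C : ℝ≥0) : Prop :=
  ∀ (H : Type u) [NormedAddCommGroup H] [InnerProductSpace ℂ H] [CompleteSpace H]
    (N R : H →L[ℂ] H), IsStarNormal N → spectrum ℂ N ⊆ F →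
      ‖cfc f N * R - R * cfc f N‖ ≤ C * ‖N * R - R * N‖

/-- `f ∈ CL(F)`: `f` is a commutator Lipschitz function on the closed set `F`. -/
def IsCL (F : Set ℂ) (f : ℂ → ℂ) : Prop :=
  ContinuousOn f F ∧ ∃ C : ℝ≥0, CommutatorBound.{u} F f C

/-- The seminorm `‖f‖_{CL(F)}`: the least admissible constant, and `∞` if `f ∉ CL(F)`. -/
def clNorm (F : Set ℂ) (f : ℂ → ℂ) : ℝ≥0∞ :=
  ⨅ (C : ℝ≥0) (_ : ContinuousOn f F ∧ CommutatorBound.{u} F f C), (C : ℝ≥0∞)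

/-! ### The space `(CL)'(𝔻)` -/

/-- `g ∈ CL(𝔻) = CL(clos 𝔻)`, and the complex derivative of `g` (taken within the closed disc)
equals `h` everywhere on the closed disc. -/
def IsCLPrimitive (g h : ℂ → ℂ) : Prop :=
  IsCL.{u} (closedBall 0 1) g ∧
    ∀ z ∈ closedBall (0 : ℂ) 1, HasDerivWithinAt g (h z) (closedBall 0 1) z

/-- `h ∈ (CL)'(𝔻) = {g' : g ∈ CL(𝔻)}`, for a function `h` given on the closed disc. -/
def IsCLDeriv (h : ℂ → ℂ) : Prop := ∃ g : ℂ → ℂ, IsCLPrimitive.{u} g h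

/-- The norm `‖g'‖_{(CL)'(𝔻)} = ‖g‖_{CL(𝔻)}`, and `∞` if `h ∉ (CL)'(𝔻)`. All primitives `g`
of `h` have the same seminorm, see `clDerivNorm_eq`. -/
def clDerivNorm (h : ℂ → ℂ) : ℝ≥0∞ :=
  ⨅ (g : ℂ → ℂ) (_ : IsCLPrimitive.{u} g h), clNorm.{u} (closedBall 0 1) g

theorem CommutatorBound.add_const {F : Set ℂ} {g₁ g₂ : ℂ → ℂ} {c : ℂ} {C : ℝ≥0}
    (hg : ContinuousOn g₁ F) (h : EqOn g₂ (fun z => g₁ z + c) F)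
    (hC : CommutatorBound.{u} F g₁ C) : CommutatorBound.{u} F g₂ C := by
  intro H _ _ _ N R hN hs
  have e : cfc g₂ N = cfc g₁ N + algebraMap ℂ (H →L[ℂ] H) c := by
    rw [cfc_congr (h.mono hs), cfc_add_const c g₁ N (hg.mono hs)]
  have := hC H N R hN hs
  rw [e, add_mul, mul_add, Algebra.commutes c R, add_sub_add_right_eq_sub]
  exact this

theorem IsCLPrimitive.clNorm_le {g₁ g₂ h : ℂ → ℂ} (h₁ : IsCLPrimitive.{u} g₁ h)
    (h₂ : IsCLPrimitive.{u} g₂ h) :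
    clNorm.{u} (closedBall 0 1) g₂ ≤ clNorm.{u} (closedBall 0 1) g₁ := by
  have key : EqOn g₂ (fun z => g₁ z + (g₂ 0 - g₁ 0)) (closedBall 0 1) := by
    intro z hz
    have h0 : (0 : ℂ) ∈ closedBall (0 : ℂ) 1 := by simp
    have := (convex_closedBall (0 : ℂ) 1).norm_image_sub_le_of_norm_hasDerivWithin_le
      (f := fun z => g₂ z - g₁ z) (f' := fun z => h z - h z) (C := 0)
      (fun x hx => (h₂.2 x hx).sub (h₁.2 x hx)) (by simp) h0 hz
    rw [zero_mul, norm_le_zero_iff, sub_eq_zero] at this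
    simp only at this ⊢
    rw [← this]; ring
  refine le_iInf₂ fun C hC => iInf₂_le C ⟨h₂.1.1, ?_⟩
  exact CommutatorBound.add_const hC.1 key hC.2

/-- The norm of `(CL)'(𝔻)` does not depend on the primitive. -/
theorem clDerivNorm_eq {g h : ℂ → ℂ} (hg : IsCLPrimitive.{u} g h) :
    clDerivNorm.{u} h = clNorm.{u} (closedBall 0 1) g :=
  le_antisymm (iInf₂_le g hg) (le_iInf₂ fun _ hg' => hg'.clNorm_le hg)

/-! ### Strong Carleson measures in the disc -/

/-- `sup_{0 ≤ r < 1} ∫_𝕋 |u(rζ)| |dζ|`. -/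
def pmNorm (u : ℂ → ℂ) : ℝ≥0∞ :=
  ⨆ r ∈ Ico (0 : ℝ) 1, ∫⁻ θ in Ioc (0 : ℝ) (2 * Real.pi), ‖u (circleMap 0 r θ)‖ₑ

/-- `u ∈ PM(𝔻)`: `u` is a complex harmonic function in the disc with finite `PM`-norm. -/
def IsPM (u : ℂ → ℂ) : Prop :=
  InnerProductSpace.HarmonicOnNhd u (ball 0 1) ∧ pmNorm u < ∞

/-- A positive measure `μ` in the disc is a Carleson measure in the strong sense if
`∫_𝔻 |u| dμ < ∞` for all `u ∈ PM(𝔻)`. -/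
def IsStrongCarleson (μ : Measure ℂ) : Prop :=
  ∀ u : ℂ → ℂ, IsPM u → ∫⁻ z in ball 0 1, ‖u z‖ₑ ∂μ < ∞

/-- `sup {∫_𝔻 |u| dμ : u ∈ PM(𝔻), ‖u‖_{PM(𝔻)} ≤ 1}` for a positive measure `μ`. -/
def strongCarlesonNorm (μ : Measure ℂ) : ℝ≥0∞ :=
  ⨆ (u : ℂ → ℂ) (_ : IsPM u ∧ pmNorm u ≤ 1), ∫⁻ z in ball 0 1, ‖u z‖ₑ ∂μ

/-- The total variation `|φ dm₂| = |φ| dm₂` of the complex measure `φ dm₂` in the disc, where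
`m₂` is the planar Lebesgue measure. -/
def densityVariation (φ : ℂ → ℂ) : Measure ℂ :=
  (volume.restrict (ball 0 1)).withDensity fun z => ‖φ z‖ₑ

/-- `φ dm₂ ∈ CM_s(𝔻)`. -/
def DensityMemCMs (φ : ℂ → ℂ) : Prop := IsStrongCarleson (densityVariation φ)

/-- `‖φ dm₂‖_{CM_s(𝔻)}`. -/
def densityCMsNorm (φ : ℂ → ℂ) : ℝ≥0∞ := strongCarlesonNorm (densityVariation φ)

/-! ### Boundary values -/

/-- The nontangential approach region at the point `ζ` of the unit circle. -/
def stolzRegion (ζ : ℂ) (M : ℝ) : Set ℂ := {z | ‖z‖ < 1 ∧ ‖ζ - z‖ < M * (1 - ‖z‖)}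

/-- `f` has the nontangential (angular) boundary value `a` at the point `ζ` of the unit circle. -/
def HasBoundaryValue (f : ℂ → ℂ) (ζ a : ℂ) : Prop :=
  ∀ M : ℝ, Tendsto f (𝓝[stolzRegion ζ M] ζ) (𝓝 a)

end

/-! Write `k_w(z) = (1 - conj w * z)⁻¹`. Cauchy's formula on circles and integration in the radius
give `f(z) - f(0) = ∫ φ(w) k_w(z)² dm₂(w)`, with `φ(w) = π⁻¹ (conj w)⁻¹ f'(w) (1 - |w|²)`. Since `z
k_w(z)` has derivative `k_w(z)²`, the natural primitive of `f - f(0)` is `g(z) = ∫ φ(w) z k_w(z)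
dm₂(w)`.

Everything rests on `K = sup_{|z| ≤ 1} ∫ |φ| |k_w(z)|² dm₂(w)`. The quantity `(1 - |w|²) |k_w(z)|²`
is at most the Poisson kernel, a positive harmonic function of `w` with value 1 at 0 and hence of
`PM`-norm at most `2π`. So `K ≤ π⁻¹ · 2π · ‖ζ⁻¹ f' dm₂‖ = 2 ‖ζ⁻¹ f' dm₂‖`, which is the constant of
the theorem.

For normal `N`, the commutator of `R` with `z k_w(z)` evaluated at `N` is `V [N, R] V` with `V =
k_w(N)` (`commutator_cfc_mul_diskKernel`). The functional calculus turns the bound on `K` into `∫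
|φ| ‖k_w(N) x‖² ≤ K ‖x‖²` (`integral_norm_cfc_diskKernel_apply`). As `‖V* y‖ = ‖V y‖`, pairing with
unit vectors and using `2ab ≤ a² + b²` gives `‖[g(N), R]‖ ≤ K ‖[N, R]‖`.

The same `K` yields differentiability of `g` up to the circle, by a weak convergence argument in
`L²(|φ|)`. Nontangential limits follow by dominated convergence, because `|k_w(z)|` is comparable
from above with `|k_w(ζ)|` in a Stolz region. -/

open scoped ComplexConjugate

/-! ### The Cauchy kernel and a weak convergence criterion -/

/-- The Cauchy kernel `(1 - conj w * z)⁻¹` of the unit disc. -/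
noncomputable def diskKernel (z w : ℂ) : ℂ := (1 - conj w * z)⁻¹

theorem one_sub_norm_le_norm_one_sub {z w : ℂ} (hz : ‖z‖ ≤ 1) :
    1 - ‖w‖ ≤ ‖1 - conj w * z‖ := by
  have h := norm_sub_norm_le (1 : ℂ) (conj w * z)
  have h2 : ‖conj w * z‖ ≤ ‖w‖ := by
    rw [norm_mul, RCLike.norm_conj]
    exact mul_le_of_le_one_right (norm_nonneg _) hz
  rw [norm_one] at h
  linarith

theorem one_sub_conj_mul_ne_zero {z w : ℂ} (hz : ‖z‖ ≤ 1) (hw : ‖w‖ < 1) :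
    1 - conj w * z ≠ 0 := by
  rw [← norm_pos_iff]
  linarith [one_sub_norm_le_norm_one_sub (w := w) hz]

theorem norm_diskKernel_le {z w : ℂ} (hz : ‖z‖ ≤ 1) (hw : ‖w‖ < 1) :
    ‖diskKernel z w‖ ≤ (1 - ‖w‖)⁻¹ := by
  rw [diskKernel, norm_inv]
  exact inv_anti₀ (by linarith) (one_sub_norm_le_norm_one_sub hz)

@[fun_prop]
theorem measurable_diskKernel (z : ℂ) : Measurable (diskKernel z) := by
  unfold diskKernel
  fun_prop

theorem continuousOn_diskKernel :
    ContinuousOn (fun p : ℂ × ℂ => diskKernel p.2 p.1) (ball 0 1 ×ˢ closedBall 0 1) := by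
  unfold diskKernel
  refine ContinuousOn.inv₀ (by fun_prop) fun p hp => ?_
  exact one_sub_conj_mul_ne_zero (by simpa using hp.2) (by simpa using hp.1)

theorem continuousOn_diskKernel_left {w : ℂ} (hw : ‖w‖ < 1) :
    ContinuousOn (fun z => diskKernel z w) (closedBall 0 1) := by
  unfold diskKernel
  refine ContinuousOn.inv₀ (by fun_prop) fun z hz => ?_
  exact one_sub_conj_mul_ne_zero (by simpa using hz) hw

/-- The divided difference of `z k_w(z)` separates the variables. This drives the difference
quotients of the Cauchy transform; its operator analogue is `commutator_cfc_mul_diskKernel`. -/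
theorem diskKernel_sub {z z' w : ℂ} (hz : ‖z‖ ≤ 1) (hz' : ‖z'‖ ≤ 1) (hw : ‖w‖ < 1) :
    z' * diskKernel z' w - z * diskKernel z w =
      (z' - z) * (diskKernel z w * diskKernel z' w) := by
  have h := one_sub_conj_mul_ne_zero hz hw
  have h' := one_sub_conj_mul_ne_zero hz' hw
  unfold diskKernel
  rw [← div_eq_mul_inv, ← div_eq_mul_inv, div_sub_div _ _ h' h, ← mul_inv, ← div_eq_mul_inv,
    mul_comm (1 - conj w * z)]
  congr 1
  ring

/-- A weak convergence criterion in a weighted `L²` space: bounded sequences that tend to zero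
almost everywhere tend to zero weakly. -/
theorem tendsto_integral_mul_mul_zero {α ι : Type*} [MeasurableSpace α] {μ : Measure α}
    {l : Filter ι} [l.IsCountablyGenerated] {q a : α → ℝ} {b : ι → α → ℝ} {B : ℝ}
    (hq : ∀ x, 0 ≤ q x) (ha : ∀ x, 0 ≤ a x) (hb : ∀ i x, 0 ≤ b i x)
    (hqm : AEStronglyMeasurable q μ) (ham : AEStronglyMeasurable a μ)
    (hbm : ∀ i, AEStronglyMeasurable (b i) μ)
    (hqa : Integrable (fun x => q x * a x ^ 2) μ)
    (hqb : ∀ᶠ i in l, Integrable (fun x => q x * b i x ^ 2) μ)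
    (hB : ∀ᶠ i in l, ∫ x, q x * b i x ^ 2 ∂μ ≤ B)
    (hlim : ∀ᵐ x ∂μ, Tendsto (fun i => b i x) l (𝓝 0)) :
    Tendsto (fun i => ∫ x, q x * (a x * b i x) ∂μ) l (𝓝 0) := by
  -- Truncate `b` at `a / ε`. The truncated product is dominated by `q a² / ε`, and where `b > a /
  -- ε` one has `a b ≤ ε b²`, whose integral is at most `ε B`.
  have hmeas (ε : ℝ) (i : ι) :
      AEStronglyMeasurable (fun x => q x * (a x * min (b i x) (a x / ε))) μ := by
    refine hqm.mul (ham.mul ((hbm i).inf ?_))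
    simpa only [div_eq_mul_inv] using ham.mul_const ε⁻¹
  have hdom {ε : ℝ} (hε : 0 < ε) (i : ι) (x : α) :
      ‖q x * (a x * min (b i x) (a x / ε))‖ ≤ q x * a x ^ 2 / ε := by
    have h0 : 0 ≤ min (b i x) (a x / ε) := le_min (hb i x) (div_nonneg (ha x) hε.le)
    rw [Real.norm_of_nonneg (mul_nonneg (hq x) (mul_nonneg (ha x) h0))]
    calc q x * (a x * min (b i x) (a x / ε)) ≤ q x * (a x * (a x / ε)) := by
          gcongr
          · exact hq x
          · exact ha x
          · exact min_le_right _ _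
      _ = _ := by ring
  have trunc (ε : ℝ) (hε : 0 < ε) :
      Tendsto (fun i => ∫ x, q x * (a x * min (b i x) (a x / ε)) ∂μ) l (𝓝 0) := by
    have := tendsto_integral_filter_of_dominated_convergence (μ := μ) (l := l)
      (F := fun i x => q x * (a x * min (b i x) (a x / ε))) (f := fun _ => 0)
      (fun x => q x * a x ^ 2 / ε) ?_ ?_ (hqa.div_const ε) ?_
    · simpa using this
    · exact .of_forall (hmeas ε)
    · exact .of_forall fun i => .of_forall (hdom hε i)
    · filter_upwards [hlim] with x hx
      have h1 : Tendsto (fun i => min (b i x) (a x / ε)) l (𝓝 (min 0 (a x / ε))) :=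
        hx.min tendsto_const_nhds
      rw [min_eq_left (div_nonneg (ha x) hε.le)] at h1
      simpa using (h1.const_mul (a x)).const_mul (q x)
  rw [Metric.tendsto_nhds]
  intro δ hδ
  set ε : ℝ := δ / (2 * (|B| + 1)) with hεdef
  have hB1 : 0 < |B| + 1 := by positivity
  have hε : 0 < ε := by positivity
  have hεB : ε * |B| < δ / 2 := by
    have : ε * (|B| + 1) = δ / 2 := by rw [hεdef]; field_simp
    nlinarith
  filter_upwards [hqb, hB, (Metric.tendsto_nhds.1 (trunc ε hε)) (δ / 2) (by positivity)]
    with i hi hBi hti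
  rw [dist_zero_right] at hti ⊢
  have hnn : 0 ≤ ∫ x, q x * (a x * b i x) ∂μ :=
    integral_nonneg fun x => mul_nonneg (hq x) (mul_nonneg (ha x) (hb i x))
  rw [Real.norm_of_nonneg hnn]
  have hint : Integrable (fun x => q x * (a x * min (b i x) (a x / ε))) μ := by
    exact (hqa.div_const ε).mono' (hmeas ε i) (.of_forall (hdom hε i))
  have hle : ∫ x, q x * (a x * b i x) ∂μ ≤
      ∫ x, (ε * (q x * b i x ^ 2) + q x * (a x * min (b i x) (a x / ε))) ∂μ := by
    refine integral_mono_of_nonneg ?_ ((hi.const_mul ε).add hint) ?_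
    · exact .of_forall fun x => mul_nonneg (hq x) (mul_nonneg (ha x) (hb i x))
    · refine .of_forall fun x => ?_
      rcases le_total (b i x) (a x / ε) with h | h
      · simp only [min_eq_left h]
        have := mul_nonneg hε.le (mul_nonneg (hq x) (sq_nonneg (b i x)))
        linarith
      · simp only [min_eq_right h]
        have h1 : a x ≤ ε * b i x := by
          rw [div_le_iff₀ hε] at h
          linarith
        have h2 : q x * (a x * b i x) ≤ q x * ((ε * b i x) * b i x) := by
          gcongr
          · exact hq x
          · exact hb i x
        have h3 : 0 ≤ q x * (a x * (a x / ε)) :=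
          mul_nonneg (hq x) (mul_nonneg (ha x) (div_nonneg (ha x) hε.le))
        nlinarith
  rw [integral_add (hi.const_mul ε) hint, integral_const_mul] at hle
  have h1 : ε * ∫ x, q x * b i x ^ 2 ∂μ ≤ ε * |B| := by
    gcongr
    exact hBi.trans (le_abs_self B)
  have h2 := le_abs_self (∫ x, q x * (a x * min (b i x) (a x / ε)) ∂μ)
  rw [Real.norm_eq_abs] at hti
  linarith

/-! ### Boundary regularity of the Cauchy transform -/

section CauchyTransform

variable {S : Set ℂ} {φ : ℂ → ℂ} {K : ℝ}

theorem integrableOn_mul_diskKernel_mul {z z' : ℂ} (hS : MeasurableSet S) (hφ : ContinuousOn φ S)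
    (hz : IntegrableOn (fun w => ‖φ w‖ * ‖diskKernel z w‖ ^ 2) S)
    (hz' : IntegrableOn (fun w => ‖φ w‖ * ‖diskKernel z' w‖ ^ 2) S) :
    IntegrableOn (fun w => φ w * (diskKernel z w * diskKernel z' w)) S := by
  refine Integrable.mono' ((hz.add hz').div_const 2) ?_ (.of_forall fun w => ?_)
  · exact (hφ.aestronglyMeasurable hS).mul
      ((measurable_diskKernel z).mul (measurable_diskKernel z')).aestronglyMeasurable
  · simp only [norm_mul, Pi.add_apply]
    nlinarith [norm_nonneg (φ w),
      mul_nonneg (norm_nonneg (φ w)) (sq_nonneg (‖diskKernel z w‖ - ‖diskKernel z' w‖))]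

theorem integrableOn_mul_mul_diskKernel {z : ℂ} (hS : MeasurableSet S) (hSb : S ⊆ ball 0 1)
    (hφ : ContinuousOn φ S) (hint : IntegrableOn (fun w => ‖φ w‖ * (1 - ‖w‖)⁻¹) S)
    (hz : ‖z‖ ≤ 1) : IntegrableOn (fun w => φ w * (z * diskKernel z w)) S := by
  refine Integrable.mono' hint ?_ ((ae_restrict_iff' hS).2 (.of_forall fun w hw => ?_))
  · exact (hφ.aestronglyMeasurable hS).mul
      (measurable_const.mul (measurable_diskKernel z)).aestronglyMeasurable
  · simp only [norm_mul]
    have := norm_diskKernel_le hz (by simpa using hSb hw)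
    gcongr
    calc _ ≤ 1 * ‖diskKernel z w‖ := by gcongr
      _ ≤ _ := by rwa [one_mul]

/-- If the squares of the Cauchy kernels are uniformly integrable against `φ` then the Cauchy
transform of `φ` has a derivative at every point of the closed disc. -/
theorem hasDerivWithinAt_integral_diskKernel (hS : MeasurableSet S) (hSb : S ⊆ ball 0 1)
    (hφ : ContinuousOn φ S) (hint : IntegrableOn (fun w => ‖φ w‖ * (1 - ‖w‖)⁻¹) S)
    (hI : ∀ z ∈ closedBall (0 : ℂ) 1, IntegrableOn (fun w => ‖φ w‖ * ‖diskKernel z w‖ ^ 2) S)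
    (hK : ∀ z ∈ closedBall (0 : ℂ) 1, ∫ w in S, ‖φ w‖ * ‖diskKernel z w‖ ^ 2 ≤ K)
    {z : ℂ} (hz : z ∈ closedBall (0 : ℂ) 1) :
    HasDerivWithinAt (fun z => ∫ w in S, φ w * (z * diskKernel z w))
      (∫ w in S, φ w * diskKernel z w ^ 2) (closedBall 0 1) z := by
  have hz1 : ‖z‖ ≤ 1 := by simpa using hz
  rw [hasDerivWithinAt_iff_tendsto_slope]
  set l := 𝓝[closedBall (0 : ℂ) 1 \ {z}] z
  have hmem : ∀ᶠ z' in l, z' ∈ closedBall (0 : ℂ) 1 \ {z} := self_mem_nhdsWithin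
  have hint2 : ∀ z' ∈ closedBall (0 : ℂ) 1,
      ∀ w, ‖φ w‖ * ‖diskKernel z' w - diskKernel z w‖ ^ 2 ≤
        2 * (‖φ w‖ * ‖diskKernel z' w‖ ^ 2) + 2 * (‖φ w‖ * ‖diskKernel z w‖ ^ 2) := by
    intro z' _ w
    have h := norm_sub_le (diskKernel z' w) (diskKernel z w)
    have h2 : ‖diskKernel z' w - diskKernel z w‖ ^ 2 ≤
        2 * ‖diskKernel z' w‖ ^ 2 + 2 * ‖diskKernel z w‖ ^ 2 := by
      have h3 : ‖diskKernel z' w - diskKernel z w‖ ^ 2 ≤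
          (‖diskKernel z' w‖ + ‖diskKernel z w‖) ^ 2 := by gcongr
      nlinarith [sq_nonneg (‖diskKernel z' w‖ - ‖diskKernel z w‖)]
    nlinarith [mul_le_mul_of_nonneg_left h2 (norm_nonneg (φ w))]
  have hintd : ∀ z' ∈ closedBall (0 : ℂ) 1,
      IntegrableOn (fun w => ‖φ w‖ * ‖diskKernel z' w - diskKernel z w‖ ^ 2) S := by
    intro z' hz'
    refine Integrable.mono' (((hI z' hz').const_mul 2).add ((hI z hz).const_mul 2)) ?_ ?_
    · exact (hφ.aestronglyMeasurable hS).norm.mul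
        (((measurable_diskKernel z').sub (measurable_diskKernel z)).norm.pow_const
          2).aestronglyMeasurable
    · refine .of_forall fun w => ?_
      rw [Real.norm_of_nonneg (by positivity)]
      exact hint2 z' hz' w
  -- The slope is `∫ φ k(z) k(z')`, so its distance to the claimed derivative is at most `∫ |φ|
  -- |k(z)| |k(z') - k(z)|`. For tangential approach `k(z')` need not be dominated by a multiple of
  -- `k(z)`, so weak convergence replaces dominated convergence. The bound `4 * K` comes from `|a -
  -- b|² ≤ 2|a|² + 2|b|²`.
  have key := tendsto_integral_mul_mul_zero (μ := volume.restrict S) (l := l)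
    (q := fun w => ‖φ w‖) (a := fun w => ‖diskKernel z w‖)
    (b := fun z' w => ‖diskKernel z' w - diskKernel z w‖) (B := 4 * K)
    (fun _ => norm_nonneg _) (fun _ => norm_nonneg _) (fun _ _ => norm_nonneg _)
    (hφ.aestronglyMeasurable hS).norm (measurable_diskKernel z).norm.aestronglyMeasurable
    (fun z' => ((measurable_diskKernel z').sub
      (measurable_diskKernel z)).norm.aestronglyMeasurable)
    (hI z hz) (hmem.mono fun z' hz' => hintd z' hz'.1)
    (hmem.mono fun z' hz' => ?_) ?_
  · rw [tendsto_iff_norm_sub_tendsto_zero]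
    refine squeeze_zero' (.of_forall fun _ => norm_nonneg _) (hmem.mono fun z' hz' => ?_) key
    have hz'1 : ‖z'‖ ≤ 1 := by simpa using hz'.1
    have hne : z' - z ≠ 0 := sub_ne_zero.2 hz'.2
    have hsl : slope (fun z => ∫ w in S, φ w * (z * diskKernel z w)) z z' =
        ∫ w in S, φ w * (diskKernel z w * diskKernel z' w) := by
      rw [slope_def_field, ← integral_sub
        (integrableOn_mul_mul_diskKernel hS hSb hφ hint hz'1)
        (integrableOn_mul_mul_diskKernel hS hSb hφ hint hz1), div_eq_iff hne, mul_comm,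
        ← integral_const_mul]
      refine setIntegral_congr_fun hS fun w hw => ?_
      rw [← mul_sub, diskKernel_sub hz1 hz'1 (by simpa using hSb hw)]
      ring
    have hsq : IntegrableOn (fun w => φ w * diskKernel z w ^ 2) S := by
      simpa only [sq] using integrableOn_mul_diskKernel_mul hS hφ (hI z hz) (hI z hz)
    rw [hsl, ← integral_sub (integrableOn_mul_diskKernel_mul hS hφ (hI z hz) (hI z' hz'.1)) hsq]
    refine (norm_integral_le_integral_norm _).trans_eq (integral_congr_ae (.of_forall fun w => ?_))
    beta_reduce
    rw [← norm_mul, ← norm_mul]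
    congr 1
    ring
  · calc _ ≤ ∫ w in S, (2 * (‖φ w‖ * ‖diskKernel z' w‖ ^ 2) +
          2 * (‖φ w‖ * ‖diskKernel z w‖ ^ 2)) :=
        integral_mono (hintd z' hz'.1) (((hI z' hz'.1).const_mul 2).add ((hI z hz).const_mul 2))
          (hint2 z' hz'.1)
      _ ≤ 4 * K := by
        rw [integral_add ((hI z' hz'.1).const_mul 2) ((hI z hz).const_mul 2),
          integral_const_mul, integral_const_mul]
        linarith [hK z hz, hK z' hz'.1]
  · refine (ae_restrict_iff' hS).2 (.of_forall fun w hw => ?_)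
    have h1 : Tendsto (fun z' => diskKernel z' w) l (𝓝 (diskKernel z w)) :=
      (continuousOn_diskKernel_left (by simpa using hSb hw) z hz).mono_left
        (nhdsWithin_mono _ sdiff_subset)
    simpa using (h1.sub_const (diskKernel z w)).norm

/-- Nontangential convergence of `∫ φ w / (1 - conj w * z) ^ 2`. -/
theorem hasBoundaryValue_integral_diskKernel_sq (hS : MeasurableSet S) (hSb : S ⊆ ball 0 1)
    (hφ : ContinuousOn φ S) {ζ : ℂ} (hζ : ‖ζ‖ ≤ 1)
    (hI : IntegrableOn (fun w => ‖φ w‖ * ‖diskKernel ζ w‖ ^ 2) S) :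
    HasBoundaryValue (fun z => ∫ w in S, φ w * diskKernel z w ^ 2) ζ
      (∫ w in S, φ w * diskKernel ζ w ^ 2) := by
  intro M
  have hmem : ∀ᶠ z in 𝓝[stolzRegion ζ M] ζ, z ∈ stolzRegion ζ M := self_mem_nhdsWithin
  refine tendsto_integral_filter_of_dominated_convergence
    (fun w => (1 + M) ^ 2 * (‖φ w‖ * ‖diskKernel ζ w‖ ^ 2)) ?_ ?_ (hI.const_mul _) ?_
  · exact .of_forall fun z => (hφ.aestronglyMeasurable hS).mul
      ((measurable_diskKernel z).pow_const 2).aestronglyMeasurable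
  · filter_upwards [hmem] with z hz
    refine (ae_restrict_iff' hS).2 (.of_forall fun w hw => ?_)
    have hw1 : ‖w‖ < 1 := by simpa using hSb hw
    obtain ⟨hz1, hz2⟩ := hz
    -- For `M ≤ 0` the approach region is empty.
    have hM : 0 < M := by
      by_contra! h
      nlinarith [norm_nonneg (ζ - z)]
    -- Here `|1 - conj w ζ| ≤ |1 - conj w z| + |ζ - z|`, and in the Stolz region the last term is at
    -- most `M (1 - |z|) ≤ M |1 - conj w z|`.
    have hk : ‖diskKernel z w‖ ≤ (1 + M) * ‖diskKernel ζ w‖ := by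
      have p1 : 0 < ‖1 - conj w * z‖ := norm_pos_iff.2 (one_sub_conj_mul_ne_zero hz1.le hw1)
      have p2 : 0 < ‖1 - conj w * ζ‖ := norm_pos_iff.2 (one_sub_conj_mul_ne_zero hζ hw1)
      have h1 : 1 - ‖z‖ ≤ ‖1 - conj w * z‖ := by
        have := one_sub_norm_le_norm_one_sub (z := conj w) (w := conj z)
          (by rw [RCLike.norm_conj]; exact hw1.le)
        simpa [mul_comm] using this
      have h2 : ‖1 - conj w * ζ‖ ≤ ‖1 - conj w * z‖ + ‖ζ - z‖ := by
        calc ‖1 - conj w * ζ‖ = ‖(1 - conj w * z) - conj w * (ζ - z)‖ := by ring_nf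
          _ ≤ ‖1 - conj w * z‖ + ‖conj w * (ζ - z)‖ := norm_sub_le _ _
          _ ≤ _ := by
            gcongr
            rw [norm_mul, RCLike.norm_conj]
            exact mul_le_of_le_one_left (norm_nonneg _) hw1.le
      unfold diskKernel
      rw [norm_inv, norm_inv, ← div_eq_mul_inv, inv_eq_one_div, div_le_div_iff₀ p1 p2]
      nlinarith
    rw [norm_mul, norm_pow]
    calc ‖φ w‖ * ‖diskKernel z w‖ ^ 2 ≤ ‖φ w‖ * ((1 + M) * ‖diskKernel ζ w‖) ^ 2 := by gcongr
      _ = _ := by ring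
  · refine (ae_restrict_iff' hS).2 (.of_forall fun w hw => ?_)
    have h1 : Tendsto (fun z => diskKernel z w) (𝓝[stolzRegion ζ M] ζ) (𝓝 (diskKernel ζ w)) :=
      (continuousOn_diskKernel_left (by simpa using hSb hw) ζ (by simpa using hζ)).mono_left
        (nhdsWithin_mono _ fun z hz => by simpa using hz.1.le)
    exact (h1.pow 2).const_mul _

end CauchyTransform

/-! ### Commutator estimates through the functional calculus -/

section FunctionalCalculus

variable {H : Type*} [NormedAddCommGroup H] [InnerProductSpace ℂ H] [CompleteSpace H]
  {N : H →L[ℂ] H}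

theorem cfc_one_sub_conj_mul (hN : IsStarNormal N) (w : ℂ) :
    cfc (fun z => 1 - conj w * z) N = 1 - conj w • N := by
  rw [cfc_sub _ _ _, cfc_const_mul _ _ _, cfc_id' ℂ N, cfc_const_one ℂ N]

theorem cfc_diskKernel_mul (hN : IsStarNormal N) (hs : spectrum ℂ N ⊆ closedBall 0 1) {w : ℂ}
    (hw : ‖w‖ < 1) : cfc (fun z => diskKernel z w) N * (1 - conj w • N) = 1 := by
  rw [← cfc_one_sub_conj_mul hN, ← cfc_mul _ _ _ ((continuousOn_diskKernel_left hw).mono hs)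
    (by fun_prop), ← cfc_const_one ℂ N]
  refine cfc_congr fun z hz => ?_
  exact inv_mul_cancel₀ (one_sub_conj_mul_ne_zero (by simpa using hs hz) hw)

theorem mul_cfc_diskKernel (hN : IsStarNormal N) (hs : spectrum ℂ N ⊆ closedBall 0 1) {w : ℂ}
    (hw : ‖w‖ < 1) : (1 - conj w • N) * cfc (fun z => diskKernel z w) N = 1 := by
  rw [← cfc_one_sub_conj_mul hN, ← cfc_mul _ _ _ (by fun_prop)
    ((continuousOn_diskKernel_left hw).mono hs), ← cfc_const_one ℂ N]
  refine cfc_congr fun z hz => ?_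
  exact mul_inv_cancel₀ (one_sub_conj_mul_ne_zero (by simpa using hs hz) hw)

/-- With `A = 1 - conj w • N` and `V = A⁻¹`, multiply the commutator by `A` on both sides: it
becomes `N R A - A R N`, in which the two terms `conj w • N R N` cancel and leave `N R - R N`. -/
theorem commutator_cfc_mul_diskKernel (hN : IsStarNormal N)
    (hs : spectrum ℂ N ⊆ closedBall 0 1) {w : ℂ} (hw : ‖w‖ < 1) (R : H →L[ℂ] H) :
    cfc (fun z => z * diskKernel z w) N * R - R * cfc (fun z => z * diskKernel z w) N =
      cfc (fun z => diskKernel z w) N * (N * R - R * N) * cfc (fun z => diskKernel z w) N := by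
  have hk := (continuousOn_diskKernel_left hw).mono hs
  have e1 : cfc (fun z => z * diskKernel z w) N = N * cfc (fun z => diskKernel z w) N := by
    rw [cfc_mul _ _ _ (by fun_prop) hk, cfc_id' ℂ N]
  have e2 : cfc (fun z => z * diskKernel z w) N = cfc (fun z => diskKernel z w) N * N := by
    have hc := (cfc_commute_cfc (fun z => z) (fun z => diskKernel z w) N).eq
    rw [cfc_id' ℂ N] at hc
    rw [e1, hc]
  set V := cfc (fun z => diskKernel z w) N
  set A := 1 - conj w • N with hA
  have h1 : V * A = 1 := cfc_diskKernel_mul hN hs hw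
  have h2 : A * V = 1 := mul_cfc_diskKernel hN hs hw
  have h3 : A * (V * N) = N := by rw [← mul_assoc, h2, one_mul]
  have h4 : N * V * A = N := by rw [mul_assoc, h1, mul_one]
  have key : A * (V * N * R - R * (N * V)) * A = N * R - R * N := by
    calc _ = A * (V * N) * R * A - A * R * (N * V * A) := by noncomm_ring
      _ = N * R * A - A * R * N := by rw [h3, h4]
      _ = _ := by
        rw [hA]
        simp only [mul_sub, sub_mul, mul_one, one_mul, mul_smul_comm, smul_mul_assoc, mul_assoc]
        abel
  nth_rw 1 [e2]
  rw [e1, ← key]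
  calc _ = (V * A) * (V * N * R - R * (N * V)) * (A * V) := by rw [h1, h2, one_mul, mul_one]
    _ = _ := by noncomm_ring

variable {S : Set ℂ} {φ : ℂ → ℂ} {K : ℝ}

theorem norm_cfc_apply_sq {k : ℂ → ℂ}
    (hk : ContinuousOn k (spectrum ℂ N)) (x : H) :
    ((‖cfc k N x‖ ^ 2 : ℝ) : ℂ) =
      inner ℂ x (cfc (fun z => ((‖k z‖ ^ 2 : ℝ) : ℂ)) N x) := by
  have e : cfc (fun z => ((‖k z‖ ^ 2 : ℝ) : ℂ)) N = star (cfc k N) * cfc k N := by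
    rw [← cfc_star, ← cfc_mul _ _ _ hk.star hk]
    refine cfc_congr fun z _ => ?_
    simp [← Complex.conj_mul']
  rw [e, mul_apply_eq_comp, ContinuousLinearMap.star_eq_adjoint,
    ContinuousLinearMap.adjoint_inner_right, inner_self_eq_norm_sq_to_K]
  simp

/-- The integrand is `⟨x, (|φ(w)| |k_w|²)(N) x⟩`, so the integral is the quadratic form of a
function of `N` bounded by `K` on the spectrum. Staying in a disc of radius `r < 1` provides a
dominating function independent of `z`, which exchanging integral and functional calculus requires.
-/
theorem setIntegral_norm_cfc_diskKernel_apply (hN : IsStarNormal N)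
    (hs : spectrum ℂ N ⊆ closedBall 0 1) (hS : MeasurableSet S) {r : ℝ} (hr : r < 1)
    (hSr : S ⊆ ball 0 r) (hφ : ContinuousOn φ S)
    (hint : IntegrableOn (fun w => ‖φ w‖ * (1 - ‖w‖)⁻¹) S)
    (hK : ∀ z ∈ closedBall (0 : ℂ) 1, ∫ w in S, ‖φ w‖ * ‖diskKernel z w‖ ^ 2 ≤ K) (x : H) :
    IntegrableOn (fun w => ‖φ w‖ * ‖cfc (fun z => diskKernel z w) N x‖ ^ 2) S ∧
      ∫ w in S, ‖φ w‖ * ‖cfc (fun z => diskKernel z w) N x‖ ^ 2 ≤ K * ‖x‖ ^ 2 := by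
  have hSb : S ⊆ ball 0 1 := hSr.trans (ball_subset_ball hr.le)
  have hK0 : 0 ≤ K := (integral_nonneg fun w => by positivity).trans (hK 0 (by simp))
  set k : ℂ → ℂ → ℂ := fun w z => ((‖φ w‖ * ‖diskKernel z w‖ ^ 2 : ℝ) : ℂ) with hk
  have hcont : ContinuousOn (Function.uncurry k) (S ×ˢ spectrum ℂ N) := by
    refine Complex.continuous_ofReal.comp_continuousOn ?_
    refine ContinuousOn.mul ?_ ((continuousOn_diskKernel.mono (prod_mono hSb hs)).norm.pow 2)
    exact (hφ.comp continuousOn_fst fun p hp => hp.1).norm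
  have hle : ∀ w ∈ S, ∀ z ∈ closedBall (0 : ℂ) 1,
      ‖φ w‖ * ‖diskKernel z w‖ ^ 2 ≤ ‖φ w‖ * (1 - ‖w‖)⁻¹ * (1 - r)⁻¹ := by
    intro w hw z hz
    have hw1 : ‖w‖ < 1 := by simpa using hSb hw
    have hwr : ‖w‖ < r := by simpa using hSr hw
    have h := norm_diskKernel_le (by simpa using hz) hw1
    have h2 : (1 - ‖w‖)⁻¹ ≤ (1 - r)⁻¹ := inv_anti₀ (by linarith) (by linarith)
    have h3 : 0 ≤ (1 - ‖w‖)⁻¹ := (norm_nonneg _).trans h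
    rw [mul_assoc, sq]
    gcongr
    exact h.trans h2
  have hbound : ∀ᵐ w ∂volume.restrict S, ∀ z ∈ spectrum ℂ N,
      ‖k w z‖ ≤ ‖φ w‖ * (1 - ‖w‖)⁻¹ * (1 - r)⁻¹ := by
    refine (ae_restrict_iff' hS).2 (.of_forall fun w hw z hz => ?_)
    rw [hk, Complex.norm_real, Real.norm_of_nonneg (by positivity)]
    exact hle w hw z (hs hz)
  have hfin := (hint.mul_const (1 - r)⁻¹).hasFiniteIntegral
  have hI := integrableOn_cfc hS k _ N hcont hbound hfin
  have hE := cfc_setIntegral hS k _ N hcont hbound hfin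
  have hpt : ∀ w ∈ S, ((‖φ w‖ * ‖cfc (fun z => diskKernel z w) N x‖ ^ 2 : ℝ) : ℂ) =
      inner ℂ x (cfc (k w) N x) := by
    intro w hw
    have hkw := (continuousOn_diskKernel_left (w := w) (by simpa using hSb hw)).mono hs
    have hk2 : ContinuousOn (fun z => ((‖diskKernel z w‖ ^ 2 : ℝ) : ℂ)) (spectrum ℂ N) :=
      Complex.continuous_ofReal.comp_continuousOn (hkw.norm.pow 2)
    have : cfc (k w) N = (‖φ w‖ : ℂ) • cfc (fun z => ((‖diskKernel z w‖ ^ 2 : ℝ) : ℂ)) N := by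
      rw [← cfc_smul _ _ _ hk2]
      simp [hk]
    rw [this, smul_apply, inner_smul_right, ← norm_cfc_apply_sq hkw]
    push_cast
    rfl
  let ℓ : (H →L[ℂ] H) →L[ℂ] ℂ := (innerSL ℂ x).comp (ContinuousLinearMap.apply ℂ H x)
  have hℓ : IntegrableOn (fun w => inner ℂ x (cfc (k w) N x)) S := ℓ.integrable_comp hI
  have hint' : IntegrableOn
      (fun w => ((‖φ w‖ * ‖cfc (fun z => diskKernel z w) N x‖ ^ 2 : ℝ) : ℂ)) S :=
    hℓ.congr_fun (fun w hw => (hpt w hw).symm) hS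
  refine ⟨hint'.re, ?_⟩
  have h1 : ((∫ w in S, ‖φ w‖ * ‖cfc (fun z => diskKernel z w) N x‖ ^ 2 : ℝ) : ℂ) =
      inner ℂ x (cfc (fun z => ∫ w in S, k w z) N x) := by
    rw [← integral_complex_ofReal, hE, setIntegral_congr_fun hS hpt]
    exact ℓ.integral_comp_comm hI
  have h2 : ‖cfc (fun z => ∫ w in S, k w z) N‖ ≤ K := by
    refine norm_cfc_le hK0 fun z hz => ?_
    rw [integral_complex_ofReal, Complex.norm_real,
      Real.norm_of_nonneg (integral_nonneg fun w => by positivity)]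
    exact hK z (hs hz)
  calc _ ≤ ‖((∫ w in S, ‖φ w‖ * ‖cfc (fun z => diskKernel z w) N x‖ ^ 2 : ℝ) : ℂ)‖ := by
        rw [Complex.norm_real]
        exact le_abs_self _
    _ ≤ ‖x‖ * (‖cfc (fun z => ∫ w in S, k w z) N‖ * ‖x‖) := by
        rw [h1]
        exact (norm_inner_le_norm _ _).trans (by gcongr; exact ContinuousLinearMap.le_opNorm _ _)
    _ ≤ ‖x‖ * (K * ‖x‖) := by gcongr
    _ = _ := by ring

/-- Exhaust the disc by the radii `1 - 1/(n+1)`; the bound for each is the same `K ‖x‖²`. A direct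
exchange would need `sup_z |φ| |k_w(z)|²` to be integrable, which is not assumed. -/
theorem integral_norm_cfc_diskKernel_apply (hN : IsStarNormal N)
    (hs : spectrum ℂ N ⊆ closedBall 0 1) (hS : MeasurableSet S) (hSb : S ⊆ ball 0 1)
    (hφ : ContinuousOn φ S) (hint : IntegrableOn (fun w => ‖φ w‖ * (1 - ‖w‖)⁻¹) S)
    (hI : ∀ z ∈ closedBall (0 : ℂ) 1, IntegrableOn (fun w => ‖φ w‖ * ‖diskKernel z w‖ ^ 2) S)
    (hK : ∀ z ∈ closedBall (0 : ℂ) 1, ∫ w in S, ‖φ w‖ * ‖diskKernel z w‖ ^ 2 ≤ K) (x : H) :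
    IntegrableOn (fun w => ‖φ w‖ * ‖cfc (fun z => diskKernel z w) N x‖ ^ 2) S ∧
      ∫ w in S, ‖φ w‖ * ‖cfc (fun z => diskKernel z w) N x‖ ^ 2 ≤ K * ‖x‖ ^ 2 := by
  set B : ℕ → Set ℂ := fun n => ball 0 (1 - 1 / ((n : ℝ) + 1)) with hB
  have hr (n : ℕ) : 1 - 1 / ((n : ℝ) + 1) < 1 := by
    have : (0 : ℝ) < 1 / ((n : ℝ) + 1) := by positivity
    linarith
  have hcov : AECover (volume.restrict S) atTop B := by
    refine ⟨(ae_restrict_iff' hS).2 (.of_forall fun w hw => ?_), fun n => measurableSet_ball⟩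
    have hw1 : ‖w‖ < 1 := by simpa using hSb hw
    have ht : Tendsto (fun n : ℕ => 1 - 1 / ((n : ℝ) + 1)) atTop (𝓝 (1 - 0)) :=
      tendsto_one_div_add_atTop_nhds_zero_nat.const_sub 1
    rw [sub_zero] at ht
    filter_upwards [ht.eventually_const_lt hw1] with n hn
    simpa [hB] using hn
  have hres (n : ℕ) : (volume.restrict S).restrict (B n) = volume.restrict (B n ∩ S) :=
    Measure.restrict_restrict measurableSet_ball
  have htr (n : ℕ) := setIntegral_norm_cfc_diskKernel_apply (K := K) hN hs
    (measurableSet_ball.inter hS) (hr n) (inter_subset_left (s := B n) (t := S))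
    (hφ.mono inter_subset_right) (hint.mono_set inter_subset_right)
    (fun z hz => (setIntegral_mono_set (hI z hz) (.of_forall fun w => by positivity)
      (LE.le.eventuallyLE inter_subset_right)).trans (hK z hz)) x
  have hint' : IntegrableOn (fun w => ‖φ w‖ * ‖cfc (fun z => diskKernel z w) N x‖ ^ 2) S := by
    refine hcov.integrable_of_integral_norm_bounded (K * ‖x‖ ^ 2) (fun n => ?_)
      (.of_forall fun n => ?_)
    · rw [IntegrableOn, hres]
      exact (htr n).1
    · rw [hres]
      refine le_of_eq_of_le (integral_congr_ae (.of_forall fun w => ?_)) (htr n).2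
      exact Real.norm_of_nonneg (by positivity)
  refine ⟨hint', le_of_tendsto (hcov.integral_tendsto_of_countably_generated hint')
    (.of_forall fun n => ?_)⟩
  rw [hres]
  exact (htr n).2

theorem norm_star_cfc_apply {k : ℂ → ℂ} (x : H) : ‖star (cfc k N) x‖ = ‖cfc k N x‖ :=
  (ContinuousLinearMap.isStarNormal_iff_norm_eq_adjoint.1 (cfc_predicate k N) x).symm

/-- If the squares of the Cauchy kernels are uniformly integrable against `φ` then the Cauchy
transform of `φ` is a commutator Lipschitz function on the closed disc. -/
theorem norm_commutator_cfc_integral_diskKernel_le (hN : IsStarNormal N)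
    (hs : spectrum ℂ N ⊆ closedBall 0 1) (hS : MeasurableSet S) (hSb : S ⊆ ball 0 1)
    (hφ : ContinuousOn φ S) (hint : IntegrableOn (fun w => ‖φ w‖ * (1 - ‖w‖)⁻¹) S)
    (hI : ∀ z ∈ closedBall (0 : ℂ) 1, IntegrableOn (fun w => ‖φ w‖ * ‖diskKernel z w‖ ^ 2) S)
    (hK : ∀ z ∈ closedBall (0 : ℂ) 1, ∫ w in S, ‖φ w‖ * ‖diskKernel z w‖ ^ 2 ≤ K)
    (R : H →L[ℂ] H) :
    ‖cfc (fun z => ∫ w in S, φ w * (z * diskKernel z w)) N * R -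
      R * cfc (fun z => ∫ w in S, φ w * (z * diskKernel z w)) N‖ ≤ K * ‖N * R - R * N‖ := by
  have hK0 : 0 ≤ K := (integral_nonneg fun w => by positivity).trans (hK 0 (by simp))
  set k : ℂ → ℂ → ℂ := fun w z => φ w * (z * diskKernel z w) with hk
  have hcont : ContinuousOn (Function.uncurry k) (S ×ˢ spectrum ℂ N) := by
    refine ContinuousOn.mul (hφ.comp continuousOn_fst fun p hp => hp.1) ?_
    exact continuousOn_snd.mul (continuousOn_diskKernel.mono (prod_mono hSb hs))
  have hbound : ∀ᵐ w ∂volume.restrict S, ∀ z ∈ spectrum ℂ N,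
      ‖k w z‖ ≤ ‖φ w‖ * (1 - ‖w‖)⁻¹ := by
    refine (ae_restrict_iff' hS).2 (.of_forall fun w hw z hz => ?_)
    have hz : ‖z‖ ≤ 1 := by simpa using hs hz
    have h := norm_diskKernel_le hz (w := w) (by simpa using hSb hw)
    rw [hk, norm_mul, norm_mul]
    gcongr
    calc _ ≤ 1 * ‖diskKernel z w‖ := by gcongr
      _ ≤ _ := by rwa [one_mul]
  have hIk := integrableOn_cfc hS k _ N hcont hbound hint.hasFiniteIntegral
  have hE := cfc_setIntegral hS k _ N hcont hbound hint.hasFiniteIntegral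
  set D := N * R - R * N
  set V : ℂ → H →L[ℂ] H := fun w => cfc (fun z => diskKernel z w) N
  have hcomm : ∀ w ∈ S, cfc (k w) N * R - R * cfc (k w) N = φ w • (V w * D * V w) := by
    intro w hw
    have hw1 : ‖w‖ < 1 := by simpa using hSb hw
    have hkw := (continuousOn_diskKernel_left hw1).mono hs
    have hzk : ContinuousOn (fun z => z * diskKernel z w) (spectrum ℂ N) :=
      continuousOn_id.mul hkw
    have : cfc (k w) N = φ w • cfc (fun z => z * diskKernel z w) N := cfc_const_mul _ _ _ hzk
    rw [this, smul_mul_assoc, mul_smul_comm,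
      ← smul_sub, commutator_cfc_mul_diskKernel hN hs hw1]
  let Λ : (H →L[ℂ] H) →L[ℂ] (H →L[ℂ] H) :=
    (ContinuousLinearMap.mul ℂ (H →L[ℂ] H)).flip R - ContinuousLinearMap.mul ℂ (H →L[ℂ] H) R
  have hΛ (T : H →L[ℂ] H) : Λ T = T * R - R * T := rfl
  -- Norm integrability comes from the commutator side: `z k_w(z)` costs only one factor `(1 -
  -- |w|)⁻¹`, whereas bounding `V` twice would cost two.
  have hIc : IntegrableOn (fun w => φ w • (V w * D * V w)) S :=
    IntegrableOn.congr_fun (Λ.integrable_comp hIk) hcomm hS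
  have hEc : cfc (fun z => ∫ w in S, k w z) N * R - R * cfc (fun z => ∫ w in S, k w z) N =
      ∫ w in S, φ w • (V w * D * V w) := by
    rw [hE, ← hΛ, ← Λ.integral_comp_comm hIk]
    exact setIntegral_congr_fun hS hcomm
  rw [hEc]
  -- Testing on unit vectors lets `2ab ≤ a² + b²` replace the Cauchy–Schwarz inequality for the
  -- `w`-integral without losing a constant.
  refine ContinuousLinearMap.opNorm_le_of_re_inner_le (by positivity) fun x y hx hy => ?_
  have hx2 := integral_norm_cfc_diskKernel_apply hN hs hS hSb hφ hint hI hK x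
  have hy2 := integral_norm_cfc_diskKernel_apply hN hs hS hSb hφ hint hI hK y
  let ℓ : (H →L[ℂ] H) →L[ℂ] ℂ := (innerSL ℂ y).comp (ContinuousLinearMap.apply ℂ H x)
  have hℓ : inner ℂ y ((∫ w in S, φ w • (V w * D * V w)) x) =
      ∫ w in S, ℓ (φ w • (V w * D * V w)) := (ℓ.integral_comp_comm hIc).symm
  have hpt : ∀ w, ‖ℓ (φ w • (V w * D * V w))‖ ≤
      ‖D‖ / 2 * (‖φ w‖ * ‖V w x‖ ^ 2 + ‖φ w‖ * ‖V w y‖ ^ 2) := by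
    intro w
    have e : ℓ (φ w • (V w * D * V w)) = φ w * inner ℂ (star (V w) y) (D (V w x)) := by
      rw [ContinuousLinearMap.star_eq_adjoint, ContinuousLinearMap.adjoint_inner_left,
        ← inner_smul_right]
      rfl
    have h : ‖inner ℂ (star (V w) y) (D (V w x))‖ ≤ ‖V w y‖ * (‖D‖ * ‖V w x‖) := by
      rw [← norm_star_cfc_apply]
      exact (norm_inner_le_norm _ _).trans (by gcongr; exact ContinuousLinearMap.le_opNorm _ _)
    rw [e, norm_mul]
    calc _ ≤ ‖φ w‖ * (‖V w y‖ * (‖D‖ * ‖V w x‖)) := by gcongr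
      _ = ‖D‖ / 2 * (‖φ w‖ * (2 * ‖V w x‖ * ‖V w y‖)) := by ring
      _ ≤ ‖D‖ / 2 * (‖φ w‖ * (‖V w x‖ ^ 2 + ‖V w y‖ ^ 2)) := by
        gcongr
        exact two_mul_le_add_sq _ _
      _ = _ := by ring
  calc _ ≤ ‖inner ℂ ((∫ w in S, φ w • (V w * D * V w)) x) y‖ := RCLike.re_le_norm _
    _ = ‖∫ w in S, ℓ (φ w • (V w * D * V w))‖ := by rw [norm_inner_symm, hℓ]
    _ ≤ ∫ w in S, ‖D‖ / 2 * (‖φ w‖ * ‖V w x‖ ^ 2 + ‖φ w‖ * ‖V w y‖ ^ 2) :=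
      norm_integral_le_of_norm_le ((hx2.1.add hy2.1).const_mul _) (.of_forall hpt)
    _ = ‖D‖ / 2 * ((∫ w in S, ‖φ w‖ * ‖V w x‖ ^ 2) + ∫ w in S, ‖φ w‖ * ‖V w y‖ ^ 2) := by
      rw [integral_const_mul, integral_add hx2.1 hy2.1]
    _ ≤ ‖D‖ / 2 * (K * ‖x‖ ^ 2 + K * ‖y‖ ^ 2) := by
      gcongr
      · exact hx2.2
      · exact hy2.2
    _ = _ := by
      rw [hx, hy]
      ring

end FunctionalCalculus

/-! ### Recovering an analytic function from its derivative -/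

section ReproducingFormula

/-- On `|w| = r` one has `conj w = r² / w`, so the kernel becomes `w / (w - s)` with `s = r² z`
inside the circle. The integral is then Cauchy's formula for the derivative of `w² f'(w)` at `s`. -/
theorem intervalIntegral_circle_deriv_mul_diskKernel_sq {f : ℂ → ℂ}
    (hf : AnalyticOnNhd ℂ f (ball 0 1)) {z : ℂ} (hz : ‖z‖ < 1) {r : ℝ} (hr : 0 < r)
    (hr1 : r < 1) :
    ∫ θ in (0 : ℝ)..2 * Real.pi, (conj (circleMap 0 r θ))⁻¹ * deriv f (circleMap 0 r θ) *
        diskKernel z (circleMap 0 r θ) ^ 2 =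
      2 * Real.pi * (2 * z * deriv f (r ^ 2 * z) + r ^ 2 * z ^ 2 * deriv (deriv f) (r ^ 2 * z)) := by
  have hrC : (r : ℂ) ≠ 0 := by exact_mod_cast hr.ne'
  have hf' := hf.deriv
  set s : ℂ := r ^ 2 * z with hs
  have hsr : ‖s‖ < r := by
    rw [hs, norm_mul, norm_pow, Complex.norm_real, Real.norm_of_nonneg hr.le]
    nlinarith [norm_nonneg z, mul_pos hr hr]
  have hQ : DifferentiableOn ℂ (fun w => w ^ 2 * deriv f w) (ball 0 1) :=
    (differentiableOn_id.pow 2).mul hf'.differentiableOn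
  have hC := Complex.two_pi_I_inv_smul_circleIntegral_sub_sq_inv_smul_of_differentiable
    isOpen_ball (closedBall_subset_ball hr1) hQ (mem_ball_zero_iff.2 hsr)
  have hQd : deriv (fun w => w ^ 2 * deriv f w) s =
      2 * s * deriv f s + s ^ 2 * deriv (deriv f) s := by
    have h1 := (hf' s (mem_ball_zero_iff.2 (hsr.trans hr1))).differentiableAt.hasDerivAt
    have h2 : HasDerivAt (fun w => w ^ 2 * deriv f w)
        (2 * s * deriv f s + s ^ 2 * deriv (deriv f) s) s :=
      (((hasDerivAt_id s).pow 2).mul h1).congr_deriv (by simp)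
    exact h2.deriv
  have hpt : ∀ θ : ℝ, (conj (circleMap 0 r θ))⁻¹ * deriv f (circleMap 0 r θ) *
        diskKernel z (circleMap 0 r θ) ^ 2 = (Complex.I * r ^ 2)⁻¹ *
      (deriv (circleMap 0 r) θ • (((circleMap 0 r θ - s) ^ 2)⁻¹ •
        (circleMap 0 r θ ^ 2 * deriv f (circleMap 0 r θ)))) := by
    intro θ
    have hw : ‖circleMap 0 r θ‖ = r := by simp [abs_of_pos hr]
    rw [deriv_circleMap]
    set w := circleMap 0 r θ
    have hw0 : w ≠ 0 := by
      rw [← norm_pos_iff, hw]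
      exact hr
    have hconj : conj w = r ^ 2 / w := by
      rw [eq_div_iff hw0, Complex.conj_mul', hw]
    have hws : w - s ≠ 0 := by
      rw [sub_ne_zero]
      rintro h
      rw [← h, hw] at hsr
      exact lt_irrefl _ hsr
    have hk : diskKernel z w = w / (w - s) := by
      rw [diskKernel, hconj, inv_eq_iff_eq_inv, inv_div, hs]
      field_simp
    rw [hk, hconj]
    simp only [smul_eq_mul]
    field_simp [Complex.I_ne_zero]
  rw [intervalIntegral.integral_congr (fun θ _ => hpt θ), intervalIntegral.integral_const_mul]
  have hC' : (∫ θ in (0 : ℝ)..2 * Real.pi, deriv (circleMap 0 r) θ •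
      (((circleMap 0 r θ - s) ^ 2)⁻¹ • (circleMap 0 r θ ^ 2 * deriv f (circleMap 0 r θ)))) =
      2 * Real.pi * Complex.I * deriv (fun w => w ^ 2 * deriv f w) s := by
    rw [← hC, smul_eq_mul, mul_inv_cancel_left₀]
    · rfl
    · exact Complex.two_pi_I_ne_zero
  rw [hC', hQd, hs]
  field_simp [Complex.I_ne_zero]

/-- The integrand is the exact derivative in `r` of `(1 - r²) r² z f'(r² z) + f(r² z)`, whose first
term vanishes at both ends. -/
theorem integral_radial_primitive {f : ℂ → ℂ} (hf : AnalyticOnNhd ℂ f (ball 0 1)) {z : ℂ}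
    (hz : ‖z‖ < 1) :
    ∫ r in (0 : ℝ)..1, (2 * (r * (1 - r ^ 2)) *
        (2 * z * deriv f (r ^ 2 * z) + r ^ 2 * z ^ 2 * deriv (deriv f) (r ^ 2 * z)) : ℂ) =
      f z - f 0 := by
  have hmem : ∀ r ∈ uIcc (0 : ℝ) 1, (r : ℂ) ^ 2 * z ∈ ball (0 : ℂ) 1 := by
    intro r hr
    rw [uIcc_of_le zero_le_one] at hr
    rw [mem_ball_zero_iff, norm_mul, norm_pow, Complex.norm_real, Real.norm_of_nonneg hr.1]
    have : r ^ 2 ≤ 1 := pow_le_one₀ hr.1 hr.2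
    nlinarith [norm_nonneg z]
  have hd : ∀ r ∈ uIcc (0 : ℝ) 1, HasDerivAt
      (fun r : ℝ => ((1 - r ^ 2) * (r ^ 2 * z) * deriv f (r ^ 2 * z) + f (r ^ 2 * z) : ℂ))
      (2 * (r * (1 - r ^ 2)) *
        (2 * z * deriv f (r ^ 2 * z) + r ^ 2 * z ^ 2 * deriv (deriv f) (r ^ 2 * z)) : ℂ) r := by
    intro r hr
    have h0 := (hf _ (hmem r hr)).differentiableAt.hasDerivAt
    have h1 := (hf.deriv _ (hmem r hr)).differentiableAt.hasDerivAt
    have e1 : HasDerivAt (fun x : ℂ => x ^ 2 * z) (2 * r * z) (r : ℂ) := by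
      simpa using ((hasDerivAt_id (r : ℂ)).pow 2).mul_const z
    have e2 : HasDerivAt (fun x : ℂ => (1 - x ^ 2) * (x ^ 2 * z))
        (-(2 * r) * (r ^ 2 * z) + (1 - r ^ 2) * (2 * r * z)) (r : ℂ) :=
      ((((hasDerivAt_id (r : ℂ)).pow 2).const_sub 1).mul e1).congr_deriv (by simp)
    have e3 := (e2.mul (h1.comp (r : ℂ) e1)).add (h0.comp (r : ℂ) e1)
    exact e3.comp_ofReal.congr_deriv (by simp only [Function.comp_apply]; ring)
  have hc : ContinuousOn (fun r : ℝ => (2 * (r * (1 - r ^ 2)) *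
      (2 * z * deriv f (r ^ 2 * z) + r ^ 2 * z ^ 2 * deriv (deriv f) (r ^ 2 * z)) : ℂ))
      (uIcc 0 1) := by
    have hin : ContinuousOn (fun r : ℝ => (r : ℂ) ^ 2 * z) (uIcc 0 1) := by fun_prop
    have c1 := hf.deriv.continuousOn.comp hin hmem
    have c2 := hf.deriv.deriv.continuousOn.comp hin hmem
    have c0 : ContinuousOn (fun r : ℝ => (2 * (r * (1 - r ^ 2)) : ℂ)) (uIcc 0 1) := by fun_prop
    have c3 : ContinuousOn (fun r : ℝ => (r ^ 2 * z ^ 2 : ℂ)) (uIcc 0 1) := by fun_prop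
    exact c0.mul ((continuousOn_const.mul c1).add (c3.mul c2))
  rw [intervalIntegral.integral_eq_sub_of_hasDerivAt hd hc.intervalIntegrable]
  simp

/-- Integration in polar coordinates in the unit disc. -/
theorem integral_ball_eq_integral_polar {k : ℂ → ℂ} (hk : IntegrableOn k (ball 0 1))
    (hc : ContinuousOn k (ball 0 1 \ {0})) :
    ∫ w in ball (0 : ℂ) 1, k w =
      ∫ r in (0 : ℝ)..1, r * ∫ θ in (0 : ℝ)..2 * Real.pi, k (circleMap 0 r θ) := by
  have hpol (p : ℝ × ℝ) : Complex.polarCoord.symm p = circleMap 0 p.1 p.2 := by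
    rw [Complex.polarCoord_symm_apply, circleMap, Complex.exp_mul_I]
    simp
  set T : Set (ℝ × ℝ) := Ioo 0 1 ×ˢ Ioo (-Real.pi) Real.pi
  have hTm : MeasurableSet T := measurableSet_Ioo.prod measurableSet_Ioo
  have hTsub : T ⊆ polarCoord.target := prod_mono Ioo_subset_Ioi_self le_rfl
  have hnorm (p : ℝ × ℝ) : ‖circleMap 0 p.1 p.2‖ = |p.1| := by simp
  have hiff : ∀ p ∈ polarCoord.target, (circleMap 0 p.1 p.2 ∈ ball (0 : ℂ) 1 ↔ p ∈ T) := by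
    intro p hp
    have hp1 : 0 < p.1 := hp.1
    rw [mem_ball_zero_iff, hnorm, abs_of_pos hp1]
    exact ⟨fun h => ⟨⟨hp1, h⟩, hp.2⟩, fun h => h.1.2⟩
  have hind {E : Type} [Zero E] (g : ℂ → E) : ∀ p ∈ polarCoord.target,
      (ball (0 : ℂ) 1).indicator g (circleMap 0 p.1 p.2) =
        T.indicator (fun p => g (circleMap 0 p.1 p.2)) p := by
    intro p hp
    by_cases h : p ∈ T
    · rw [indicator_of_mem h, indicator_of_mem ((hiff p hp).2 h)]
    · rw [indicator_of_notMem h, indicator_of_notMem (fun h' => h ((hiff p hp).1 h'))]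
  have hmaps : MapsTo (fun p : ℝ × ℝ => circleMap 0 p.1 p.2) T (ball 0 1 \ {0}) := by
    intro p hp
    refine ⟨(hiff p (hTsub hp)).2 hp, ?_⟩
    have hp1 : p.1 ≠ 0 := hp.1.1.ne'
    rw [mem_singleton_iff, ← norm_eq_zero, hnorm, abs_eq_zero]
    exact hp1
  have hcont : ContinuousOn (fun p : ℝ × ℝ => (p.1 : ℂ) * k (circleMap 0 p.1 p.2)) T := by
    refine ContinuousOn.mul (by fun_prop) (hc.comp ?_ hmaps)
    unfold circleMap
    fun_prop
  have hint : IntegrableOn (fun p : ℝ × ℝ => (p.1 : ℂ) * k (circleMap 0 p.1 p.2)) T := by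
    refine ⟨hcont.aestronglyMeasurable hTm, ?_⟩
    have h := Complex.lintegral_comp_polarCoord_symm
      ((ball (0 : ℂ) 1).indicator fun w => ‖k w‖ₑ)
    rw [lintegral_indicator measurableSet_ball] at h
    rw [HasFiniteIntegral]
    refine lt_of_eq_of_lt ?_ (h.trans_lt hk.2)
    rw [← inter_eq_self_of_subset_left hTsub, ← setLIntegral_indicator hTm]
    refine setLIntegral_congr_fun polarCoord.open_target.measurableSet fun p hp => ?_
    have hp1 : 0 < p.1 := hp.1
    rw [hpol, hind _ p hp]
    by_cases hpT : p ∈ T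
    · rw [indicator_of_mem hpT, indicator_of_mem hpT, enorm_mul, smul_eq_mul,
        ← ofReal_norm (p.1 : ℂ), Complex.norm_real, Real.norm_of_nonneg hp1.le]
    · rw [indicator_of_notMem hpT, indicator_of_notMem hpT, smul_zero]
  rw [← integral_indicator measurableSet_ball, ← Complex.integral_comp_polarCoord_symm]
  have e1 : ∫ p in polarCoord.target,
      p.1 • (ball (0 : ℂ) 1).indicator k (Complex.polarCoord.symm p) =
      ∫ p in T, (p.1 : ℂ) * k (circleMap 0 p.1 p.2) := by
    rw [← inter_eq_self_of_subset_right hTsub, ← setIntegral_indicator hTm]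
    refine setIntegral_congr_fun polarCoord.open_target.measurableSet fun p hp => ?_
    rw [hpol, hind _ p hp]
    by_cases hpT : p ∈ T
    · rw [indicator_of_mem hpT, indicator_of_mem hpT, Complex.real_smul]
    · rw [indicator_of_notMem hpT, indicator_of_notMem hpT, smul_zero]
  rw [e1, Measure.volume_eq_prod, setIntegral_prod _ hint,
    intervalIntegral.integral_of_le zero_le_one, integral_Ioc_eq_integral_Ioo]
  refine setIntegral_congr_fun measurableSet_Ioo fun r _ => ?_
  dsimp only
  rw [integral_const_mul, ← integral_Ioc_eq_integral_Ioo,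
    ← intervalIntegral.integral_of_le (by linarith [Real.pi_pos])]
  -- `polarCoord` uses angles in `(-π, π)`; periodicity moves them to `(0, 2π)`.
  have hper : Function.Periodic (fun θ => k (circleMap 0 r θ)) (2 * Real.pi) := fun θ => by
    simp only [periodic_circleMap 0 r θ]
  have := hper.intervalIntegral_add_eq (-Real.pi) 0
  rw [zero_add, show -Real.pi + 2 * Real.pi = Real.pi by ring] at this
  rw [this]

theorem continuousOn_inv_conj_mul_deriv_mul {f : ℂ → ℂ} (hf : AnalyticOnNhd ℂ f (ball 0 1)) :
    ContinuousOn (fun w => (conj w)⁻¹ * deriv f w * (1 - ‖w‖ ^ 2 : ℝ)) (ball 0 1 \ {0}) := by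
  refine ContinuousOn.mul (ContinuousOn.mul ?_ (hf.deriv.continuousOn.mono sdiff_subset))
    (by fun_prop)
  refine ContinuousOn.inv₀ Complex.continuous_conj.continuousOn fun w hw => ?_
  simpa using hw.2

/-- A reproducing formula that recovers an analytic function in the disc from its derivative. -/
theorem integral_deriv_mul_diskKernel_sq {f : ℂ → ℂ} (hf : AnalyticOnNhd ℂ f (ball 0 1)) {z : ℂ}
    (hz : ‖z‖ < 1)
    (hint : IntegrableOn
      (fun w => (conj w)⁻¹ * deriv f w * (1 - ‖w‖ ^ 2 : ℝ) * diskKernel z w ^ 2) (ball 0 1)) :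
    ∫ w in ball (0 : ℂ) 1, (conj w)⁻¹ * deriv f w * (1 - ‖w‖ ^ 2 : ℝ) * diskKernel z w ^ 2 =
      Real.pi * (f z - f 0) := by
  have hk : ContinuousOn (diskKernel z) (ball 0 1) := by
    refine ContinuousOn.inv₀ (by fun_prop) fun w hw => ?_
    exact one_sub_conj_mul_ne_zero hz.le (by simpa using hw)
  rw [integral_ball_eq_integral_polar hint ((continuousOn_inv_conj_mul_deriv_mul hf).mul
    ((hk.mono sdiff_subset).pow 2)), ← integral_radial_primitive hf hz,
    ← intervalIntegral.integral_const_mul]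
  rw [intervalIntegral.integral_of_le zero_le_one, intervalIntegral.integral_of_le zero_le_one,
    integral_Ioc_eq_integral_Ioo, integral_Ioc_eq_integral_Ioo]
  refine setIntegral_congr_fun measurableSet_Ioo fun r hr => ?_
  have e : ∀ θ : ℝ, (conj (circleMap 0 r θ))⁻¹ * deriv f (circleMap 0 r θ) *
      (1 - ‖circleMap 0 r θ‖ ^ 2 : ℝ) * diskKernel z (circleMap 0 r θ) ^ 2 =
      (1 - r ^ 2) * ((conj (circleMap 0 r θ))⁻¹ * deriv f (circleMap 0 r θ) *
        diskKernel z (circleMap 0 r θ) ^ 2) := by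
    intro θ
    have : ‖circleMap 0 r θ‖ = r := by simp [abs_of_pos hr.1]
    rw [this]
    push_cast
    ring
  rw [intervalIntegral.integral_congr (fun θ _ => e θ), intervalIntegral.integral_const_mul,
    intervalIntegral_circle_deriv_mul_diskKernel_sq hf hz hr.1 hr.2]
  ring

end ReproducingFormula

/-! ### Poisson kernels as test functions for strong Carleson measures -/

section Herglotz

/-- The Herglotz kernel, whose real part is the (dilated) Poisson kernel. -/
noncomputable def herglotzKernel (z w : ℂ) : ℂ := (1 + conj z * w) / (1 - conj z * w)

theorem herglotzKernel_zero_right (z : ℂ) : herglotzKernel z 0 = 1 := by simp [herglotzKernel]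

theorem herglotzKernel_zero_left (w : ℂ) : herglotzKernel 0 w = 1 := by simp [herglotzKernel]

theorem one_sub_conj_mul_ne_zero_symm {z w : ℂ} (hz : ‖z‖ ≤ 1) (hw : ‖w‖ < 1) :
    1 - conj z * w ≠ 0 := by
  have h := one_sub_conj_mul_ne_zero (z := conj z) (w := conj w) (by rwa [RCLike.norm_conj])
    (by rwa [RCLike.norm_conj])
  rwa [Complex.conj_conj, mul_comm] at h

theorem analyticOnNhd_herglotzKernel {z : ℂ} (hz : ‖z‖ ≤ 1) :
    AnalyticOnNhd ℂ (herglotzKernel z) (ball 0 1) := by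
  unfold herglotzKernel
  intro w hw
  exact AnalyticAt.div (by fun_prop) (by fun_prop)
    (one_sub_conj_mul_ne_zero_symm hz (by simpa using hw))

theorem re_one_add_div_one_sub (a : ℂ) :
    ((1 + a) / (1 - a)).re = (1 - ‖a‖ ^ 2) / ‖1 - a‖ ^ 2 := by
  rw [Complex.div_re, ← Complex.normSq_eq_norm_sq, ← Complex.normSq_eq_norm_sq, ← add_div]
  congr 1
  simp only [Complex.normSq_apply, Complex.add_re, Complex.add_im, Complex.sub_re, Complex.sub_im,
    Complex.one_re, Complex.one_im]
  ring

/-- The real part is `(1 - |conj z w|²) / |1 - conj z w|²`, and `|conj z w| ≤ |w|`; equality holds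
on `|z| = 1`. -/
theorem mul_norm_diskKernel_sq_le_re_herglotzKernel {z w : ℂ} (hz : ‖z‖ ≤ 1) :
    (1 - ‖w‖ ^ 2) * ‖diskKernel z w‖ ^ 2 ≤ (herglotzKernel z w).re := by
  have e : ‖1 - conj w * z‖ = ‖1 - conj z * w‖ := by
    rw [← RCLike.norm_conj]
    simp [mul_comm]
  rw [herglotzKernel, re_one_add_div_one_sub, diskKernel, norm_inv, e, norm_mul, RCLike.norm_conj,
    div_eq_mul_inv, inv_pow]
  gcongr
  exact mul_le_of_le_one_left (norm_nonneg _) hz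

theorem re_herglotzKernel_nonneg {z w : ℂ} (hz : ‖z‖ ≤ 1) (hw : ‖w‖ < 1) :
    0 ≤ (herglotzKernel z w).re := by
  refine le_trans ?_ (mul_norm_diskKernel_sq_le_re_herglotzKernel hz)
  exact mul_nonneg (by nlinarith [norm_nonneg w]) (by positivity)

theorem norm_herglotzKernel_le {z w : ℂ} {r : ℝ} (hz : ‖z‖ ≤ 1) (hr : r < 1) (hw : ‖w‖ < r) :
    ‖herglotzKernel z w‖ ≤ 2 / (1 - r) := by
  have h1 : ‖conj z * w‖ < r := by
    rw [norm_mul, RCLike.norm_conj]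
    exact (mul_le_of_le_one_left (norm_nonneg _) hz).trans_lt hw
  have h2 := norm_add_le 1 (conj z * w)
  have h3 := norm_sub_norm_le 1 (conj z * w)
  rw [norm_one] at h2 h3
  rw [herglotzKernel, norm_div]
  gcongr <;> linarith

theorem harmonicOnNhd_re {h : ℂ → ℂ} (hh : AnalyticOnNhd ℂ h (ball 0 1)) :
    InnerProductSpace.HarmonicOnNhd (fun w => ((h w).re : ℂ)) (ball 0 1) := fun w hw =>
  (hh w hw).harmonicAt_re.comp_CLM Complex.ofRealCLM

/-- A nonnegative harmonic function equals its modulus, so by the mean value property all its circle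
integrals are `2π` times its value at 0. -/
theorem pmNorm_re_le {h : ℂ → ℂ} (hh : AnalyticOnNhd ℂ h (ball 0 1))
    (hre : ∀ w ∈ ball (0 : ℂ) 1, 0 ≤ (h w).re) :
    pmNorm (fun w => ((h w).re : ℂ)) ≤ ENNReal.ofReal (2 * Real.pi * (h 0).re) := by
  refine iSup₂_le fun r hr => ?_
  have hcm (θ : ℝ) : circleMap 0 r θ ∈ ball (0 : ℂ) 1 := by
    rw [mem_ball_zero_iff, norm_circleMap_zero, abs_of_nonneg hr.1]
    exact hr.2
  have hc : Continuous fun θ => (h (circleMap 0 r θ)).re :=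
    Complex.continuous_re.comp
      (hh.continuousOn.comp_continuous (continuous_circleMap 0 r) hcm)
  have hav : Real.circleAverage (fun w => (h w).re) 0 r = (h 0).re := by
    refine InnerProductSpace.HarmonicOnNhd.circleAverage_eq fun w hw => ?_
    refine (hh w ?_).harmonicAt_re
    rw [abs_of_nonneg hr.1] at hw
    exact closedBall_subset_ball hr.2 hw
  rw [Real.circleAverage, smul_eq_mul, inv_mul_eq_iff_eq_mul₀ (by positivity),
    intervalIntegral.integral_of_le (by positivity)] at hav
  rw [← hav, ofReal_integral_eq_lintegral_ofReal]
  · refine le_of_eq (lintegral_congr fun θ => ?_)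
    rw [← ofReal_norm, Complex.norm_real, Real.norm_of_nonneg (hre _ (hcm θ))]
  · exact (hc.intervalIntegrable _ _).1
  · exact .of_forall fun θ => hre _ (hcm θ)

theorem isPM_re {h : ℂ → ℂ} (hh : AnalyticOnNhd ℂ h (ball 0 1))
    (hre : ∀ w ∈ ball (0 : ℂ) 1, 0 ≤ (h w).re) : IsPM (fun w => ((h w).re : ℂ)) :=
  ⟨harmonicOnNhd_re hh, (pmNorm_re_le hh hre).trans_lt ENNReal.ofReal_lt_top⟩

/-- The integral of the Poisson kernel against a measure in the disc. -/
noncomputable def poissonBalayage (μ : Measure ℂ) (z : ℂ) : ℝ≥0∞ :=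
  ∫⁻ w in ball 0 1, ENNReal.ofReal (herglotzKernel z w).re ∂μ

theorem poissonBalayage_le_strongCarlesonNorm (μ : Measure ℂ) {z : ℂ} (hz : ‖z‖ ≤ 1) :
    poissonBalayage μ z ≤ ENNReal.ofReal (2 * Real.pi) * strongCarlesonNorm μ := by
  have hpi : 0 < 2 * Real.pi := by positivity
  set h : ℂ → ℂ := fun w => ((2 * Real.pi)⁻¹ : ℝ) * herglotzKernel z w with hdef
  have hre (w : ℂ) : (h w).re = (2 * Real.pi)⁻¹ * (herglotzKernel z w).re :=
    Complex.re_ofReal_mul _ _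
  have hh : AnalyticOnNhd ℂ h (ball 0 1) :=
    analyticOnNhd_const.mul (analyticOnNhd_herglotzKernel hz)
  have hnn : ∀ w ∈ ball (0 : ℂ) 1, 0 ≤ (h w).re := fun w hw => by
    rw [hre]
    exact mul_nonneg (by positivity) (re_herglotzKernel_nonneg hz (by simpa using hw))
  have hpm : pmNorm (fun w => ((h w).re : ℂ)) ≤ 1 := by
    refine (pmNorm_re_le hh hnn).trans_eq ?_
    rw [hre, herglotzKernel_zero_right, Complex.one_re, mul_one, mul_inv_cancel₀ hpi.ne',
      ENNReal.ofReal_one]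
  calc poissonBalayage μ z = ∫⁻ w in ball 0 1, ENNReal.ofReal (2 * Real.pi) *
        ‖((h w).re : ℂ)‖ₑ ∂μ := by
        refine setLIntegral_congr_fun measurableSet_ball fun w hw => ?_
        rw [← ofReal_norm, Complex.norm_real, Real.norm_of_nonneg (hnn w hw),
          ← ENNReal.ofReal_mul hpi.le, hre, mul_inv_cancel_left₀ hpi.ne']
    _ = ENNReal.ofReal (2 * Real.pi) * ∫⁻ w in ball 0 1, ‖((h w).re : ℂ)‖ₑ ∂μ :=
        lintegral_const_mul' _ _ ENNReal.ofReal_ne_top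
    _ ≤ _ := by
        gcongr
        exact le_iSup₂_of_le (fun w => ((h w).re : ℂ)) ⟨isPM_re hh hnn, hpm⟩ le_rfl

/-- The Poisson balayage of a strong Carleson measure is bounded. -/
theorem IsStrongCarleson.exists_poissonBalayage_le {μ : Measure ℂ} (hμ : IsStrongCarleson μ) :
    ∃ C : ℝ≥0, ∀ z ∈ closedBall (0 : ℂ) 1, poissonBalayage μ z ≤ C := by
  by_contra! hcon
  -- Gliding hump: if the balayage exceeds `4 ^ n` at `z n`, then the sum of the kernels with
  -- weights `2 ^ (-n)` is a single function with positive harmonic real part in `PM(𝔻)`. By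
  -- positivity its integral exceeds the contribution of each term, at least `2 ^ n`, contradicting
  -- the strong Carleson property.
  choose z hz hzL using fun n : ℕ => hcon (4 ^ n)
  replace hz (n : ℕ) : ‖z n‖ ≤ 1 := by simpa using hz n
  set F : ℕ → ℂ → ℂ := fun n w => ((1 / 2) ^ n : ℝ) * herglotzKernel (z n) w with hF
  have hFnorm {r : ℝ} (hr : r < 1) (n : ℕ) (w : ℂ) (hw : ‖w‖ < r) :
      ‖F n w‖ ≤ (1 / 2) ^ n * (2 / (1 - r)) := by
    rw [hF, norm_mul, Complex.norm_real, Real.norm_of_nonneg (by positivity)]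
    gcongr
    exact norm_herglotzKernel_le (hz n) hr hw
  have hsum (r : ℝ) : Summable fun n : ℕ => (1 / 2 : ℝ) ^ n * (2 / (1 - r)) :=
    summable_geometric_two.mul_right _
  have hFre (n : ℕ) (w : ℂ) : (F n w).re = (1 / 2) ^ n * (herglotzKernel (z n) w).re :=
    Complex.re_ofReal_mul _ _
  set h : ℂ → ℂ := fun w => ∑' n, F n w
  have hhd : DifferentiableOn ℂ h (ball 0 1) := by
    intro w hw
    obtain ⟨r, hwr, hr⟩ := exists_between (mem_ball_zero_iff.1 hw)
    have : DifferentiableOn ℂ h (ball 0 r) := by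
      refine Complex.differentiableOn_tsum_of_summable_norm (hsum r) (fun n => ?_) isOpen_ball
        fun n w hw => hFnorm hr n w (mem_ball_zero_iff.1 hw)
      exact ((analyticOnNhd_herglotzKernel (hz n)).differentiableOn.mono
        (ball_subset_ball hr.le)).const_mul _
    exact (this.differentiableAt (isOpen_ball.mem_nhds
      (mem_ball_zero_iff.2 hwr))).differentiableWithinAt
  have hh : AnalyticOnNhd ℂ h (ball 0 1) := hhd.analyticOnNhd isOpen_ball
  have hge (n : ℕ) : ∀ w ∈ ball (0 : ℂ) 1,
      (1 / 2) ^ n * (herglotzKernel (z n) w).re ≤ (h w).re := by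
    intro w hw
    obtain ⟨r, hwr, hr⟩ := exists_between (mem_ball_zero_iff.1 hw)
    have hs : Summable fun n => F n w :=
      .of_norm_bounded (hsum r) fun n => hFnorm hr n w hwr
    rw [← hFre]
    refine le_hasSum (Complex.hasSum_re hs.hasSum) n fun m _ => ?_
    rw [hFre]
    exact mul_nonneg (by positivity) (re_herglotzKernel_nonneg (hz m) (by simpa using hw))
  have hnn : ∀ w ∈ ball (0 : ℂ) 1, 0 ≤ (h w).re := fun w hw =>
    (mul_nonneg (by positivity) (re_herglotzKernel_nonneg (hz 0) (by simpa using hw))).trans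
      (hge 0 w hw)
  have hfin := hμ _ (isPM_re hh hnn)
  have hle (n : ℕ) : ((2 ^ n : ℕ) : ℝ≥0∞) ≤ ∫⁻ w in ball 0 1, ‖((h w).re : ℂ)‖ₑ ∂μ := by
    calc ((2 ^ n : ℕ) : ℝ≥0∞) = ENNReal.ofReal ((1 / 2) ^ n) * ((4 ^ n : ℝ≥0) : ℝ≥0∞) := by
          rw [← ENNReal.ofReal_coe_nnreal, ← ENNReal.ofReal_mul (by positivity),
            ← ENNReal.ofReal_natCast]
          congr 1
          push_cast
          rw [← mul_pow]
          norm_num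
      _ ≤ ENNReal.ofReal ((1 / 2) ^ n) * poissonBalayage μ (z n) := by
          gcongr
          exact (hzL n).le
      _ = ∫⁻ w in ball 0 1, ENNReal.ofReal ((1 / 2) ^ n) *
            ENNReal.ofReal (herglotzKernel (z n) w).re ∂μ :=
          (lintegral_const_mul' _ _ ENNReal.ofReal_ne_top).symm
      _ ≤ _ := by
          refine setLIntegral_mono' measurableSet_ball fun w hw => ?_
          rw [← ofReal_norm, Complex.norm_real, Real.norm_of_nonneg (hnn w hw),
            ← ENNReal.ofReal_mul (by positivity)]
          exact ENNReal.ofReal_le_ofReal (hge n w hw)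
  obtain ⟨m, hm⟩ := ENNReal.exists_nat_gt hfin.ne
  have h2 : ((m : ℕ) : ℝ≥0∞) ≤ ((2 ^ m : ℕ) : ℝ≥0∞) := by
    exact_mod_cast Nat.lt_two_pow_self.le
  exact absurd (h2.trans (hle m)) (not_le.2 hm)

theorem poissonBalayage_densityVariation {ψ : ℂ → ℂ} (hψ : Measurable ψ) (z : ℂ) :
    poissonBalayage (densityVariation ψ) z =
      ∫⁻ w in ball 0 1, ‖ψ w‖ₑ * ENNReal.ofReal (herglotzKernel z w).re := by
  have hm : Measurable fun w => ENNReal.ofReal (herglotzKernel z w).re := by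
    unfold herglotzKernel
    fun_prop
  rw [poissonBalayage, densityVariation, restrict_withDensity measurableSet_ball,
    Measure.restrict_restrict measurableSet_ball, inter_self,
    lintegral_withDensity_eq_lintegral_mul _ hψ.enorm hm]
  rfl

end Herglotz

/-! ### The density of the Cauchy transform and the theorem -/

section MainTheorem

theorem CommutatorBound.add_const_mul {F : Set ℂ} {g : ℂ → ℂ} {C : ℝ≥0} (hg : ContinuousOn g F)
    (hC : CommutatorBound.{u} F g C) (c : ℂ) :
    CommutatorBound.{u} F (fun z => g z + c * z) (C + ‖c‖₊) := by
  intro H _ _ _ N R hN hs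
  have e : cfc (fun z => g z + c * z) N = cfc g N + c • N := by
    rw [cfc_add _ _ _ (hg.mono hs) (by fun_prop), cfc_const_mul _ _ _, cfc_id' ℂ N]
  have e2 : (cfc g N + c • N) * R - R * (cfc g N + c • N) =
      (cfc g N * R - R * cfc g N) + c • (N * R - R * N) := by
    rw [add_mul, mul_add, smul_mul_assoc, mul_smul_comm, smul_sub]
    abel
  rw [e, e2]
  refine (norm_add_le _ _).trans ?_
  rw [norm_smul, NNReal.coe_add, coe_nnnorm, add_mul]
  gcongr
  exact hC H N R hN hs

theorem IsCLPrimitive.add_const_mul {g h : ℂ → ℂ} (hg : IsCLPrimitive.{u} g h) (c : ℂ) :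
    IsCLPrimitive.{u} (fun z => g z + c * z) (fun z => h z + c) := by
  obtain ⟨⟨hc, C, hC⟩, hd⟩ := hg
  refine ⟨⟨hc.add (by fun_prop), _, hC.add_const_mul hc c⟩, fun z hz => ?_⟩
  exact ((hd z hz).add ((hasDerivWithinAt_id z _).const_mul c)).congr_deriv (by rw [mul_one])

theorem HasBoundaryValue.congr {f g : ℂ → ℂ} {ζ a : ℂ} (hf : HasBoundaryValue f ζ a)
    (h : EqOn f g (ball 0 1)) : HasBoundaryValue g ζ a := fun M =>
  (hf M).congr' (eventually_mem_nhdsWithin.mono fun z hz => h (by simpa using hz.1))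

/-- The density whose Cauchy transform is a primitive of `f - f 0`. -/
noncomputable def cauchyDensity (f : ℂ → ℂ) (w : ℂ) : ℂ :=
  (Real.pi : ℂ)⁻¹ * ((conj w)⁻¹ * deriv f w * (1 - ‖w‖ ^ 2 : ℝ))

theorem norm_cauchyDensity (f : ℂ → ℂ) {w : ℂ} (hw : ‖w‖ < 1) :
    ‖cauchyDensity f w‖ = Real.pi⁻¹ * (‖w⁻¹ * deriv f w‖ * (1 - ‖w‖ ^ 2)) := by
  have : 0 ≤ 1 - ‖w‖ ^ 2 := by nlinarith [norm_nonneg w]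
  rw [cauchyDensity, norm_mul, norm_mul _ ((1 - ‖w‖ ^ 2 : ℝ) : ℂ), Complex.norm_real,
    Real.norm_of_nonneg this, norm_inv, Complex.norm_real, Real.norm_of_nonneg Real.pi_pos.le,
    norm_mul, norm_inv, RCLike.norm_conj, norm_mul, norm_inv]

/-- The factor `(conj w)⁻¹` may spoil continuity of the density at 0; removing this null point gives
a set on which the density is continuous. -/
theorem ball_sdiff_zero_ae_eq : (ball (0 : ℂ) 1 \ {0} : Set ℂ) =ᵐ[volume] ball (0 : ℂ) 1 :=
  sdiff_null_ae_eq_self (measure_singleton 0)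

theorem continuousOn_cauchyDensity {f : ℂ → ℂ} (hf : AnalyticOnNhd ℂ f (ball 0 1)) :
    ContinuousOn (cauchyDensity f) (ball 0 1 \ {0}) :=
  continuousOn_const.mul (continuousOn_inv_conj_mul_deriv_mul hf)

theorem measurable_inv_mul_deriv (f : ℂ → ℂ) : Measurable fun w => w⁻¹ * deriv f w :=
  measurable_inv.mul (measurable_deriv f)

theorem lintegral_cauchyDensity_mul_le (f : ℂ → ℂ) {z : ℂ} (hz : ‖z‖ ≤ 1) :
    ∫⁻ w in ball 0 1 \ {0}, ENNReal.ofReal (‖cauchyDensity f w‖ * ‖diskKernel z w‖ ^ 2) ≤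
      ENNReal.ofReal Real.pi⁻¹ *
        poissonBalayage (densityVariation fun w => w⁻¹ * deriv f w) z := by
  rw [poissonBalayage_densityVariation (measurable_inv_mul_deriv f),
    ← lintegral_const_mul' _ _ ENNReal.ofReal_ne_top, setLIntegral_congr ball_sdiff_zero_ae_eq]
  refine setLIntegral_mono' measurableSet_ball fun w hw => ?_
  rw [norm_cauchyDensity f (mem_ball_zero_iff.1 hw), ← ofReal_norm,
    ← ENNReal.ofReal_mul (norm_nonneg _), ← ENNReal.ofReal_mul (by positivity),
    mul_assoc, mul_assoc]
  refine ENNReal.ofReal_le_ofReal ?_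
  gcongr
  exact mul_norm_diskKernel_sq_le_re_herglotzKernel hz

theorem integrableOn_cauchyDensity_mul {f : ℂ → ℂ} (hf : AnalyticOnNhd ℂ f (ball 0 1)) {z : ℂ}
    (hz : ‖z‖ ≤ 1)
    (hfin : poissonBalayage (densityVariation fun w => w⁻¹ * deriv f w) z < ∞) :
    IntegrableOn (fun w => ‖cauchyDensity f w‖ * ‖diskKernel z w‖ ^ 2) (ball 0 1 \ {0}) := by
  have hS : MeasurableSet (ball (0 : ℂ) 1 \ {0}) :=
    measurableSet_ball.diff (measurableSet_singleton 0)
  refine ⟨((continuousOn_cauchyDensity hf).aestronglyMeasurable hS).norm.mul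
    ((measurable_diskKernel z).norm.pow_const 2).aestronglyMeasurable, ?_⟩
  rw [hasFiniteIntegral_iff_ofReal (.of_forall fun w => by positivity)]
  exact (lintegral_cauchyDensity_mul_le f hz).trans_lt
    (ENNReal.mul_lt_top ENNReal.ofReal_lt_top hfin)

theorem integral_cauchyDensity_mul_le {f : ℂ → ℂ} (hf : AnalyticOnNhd ℂ f (ball 0 1)) {z : ℂ}
    (hz : ‖z‖ ≤ 1) {K : ℝ≥0}
    (hfin : poissonBalayage (densityVariation fun w => w⁻¹ * deriv f w) z ≤ K) :
    ∫ w in ball 0 1 \ {0}, ‖cauchyDensity f w‖ * ‖diskKernel z w‖ ^ 2 ≤ Real.pi⁻¹ * K := by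
  have hI := integrableOn_cauchyDensity_mul hf hz (hfin.trans_lt ENNReal.coe_lt_top)
  rw [integral_eq_lintegral_of_nonneg_ae (.of_forall fun w => by positivity) hI.1]
  refine ENNReal.toReal_le_of_le_ofReal (by positivity) ?_
  refine (lintegral_cauchyDensity_mul_le f hz).trans ?_
  rw [ENNReal.ofReal_mul (by positivity), ENNReal.ofReal_coe_nnreal]
  gcongr

/-- At `z = 0` the Poisson kernel is 1, so finite balayage there means that `w⁻¹ f'` is integrable;
the factor `1 - |w|²` of the density absorbs `(1 - |w|)⁻¹`. -/
theorem integrableOn_cauchyDensity_div {f : ℂ → ℂ} (hf : AnalyticOnNhd ℂ f (ball 0 1))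
    (hfin : poissonBalayage (densityVariation fun w => w⁻¹ * deriv f w) 0 < ∞) :
    IntegrableOn (fun w => ‖cauchyDensity f w‖ * (1 - ‖w‖)⁻¹) (ball 0 1 \ {0}) := by
  have hS : MeasurableSet (ball (0 : ℂ) 1 \ {0}) :=
    measurableSet_ball.diff (measurableSet_singleton 0)
  have hψ : IntegrableOn (fun w => w⁻¹ * deriv f w) (ball 0 1 \ {0}) := by
    rw [integrableOn_congr_set_ae ball_sdiff_zero_ae_eq]
    refine ⟨(measurable_inv_mul_deriv f).aestronglyMeasurable, ?_⟩
    rw [poissonBalayage_densityVariation (measurable_inv_mul_deriv f)] at hfin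
    simpa [herglotzKernel_zero_left, HasFiniteIntegral] using hfin
  refine Integrable.mono' (hψ.norm.const_mul (2 * Real.pi⁻¹)) ?_
    ((ae_restrict_iff' hS).2 (.of_forall fun w hw => ?_))
  · exact ((continuousOn_cauchyDensity hf).aestronglyMeasurable hS).norm.mul
      (by fun_prop : Measurable fun w : ℂ => (1 - ‖w‖)⁻¹).aestronglyMeasurable
  · have hw1 : ‖w‖ < 1 := by simpa using hw.1
    have hw2 : 0 < 1 - ‖w‖ := by linarith
    rw [Real.norm_of_nonneg (by positivity), norm_cauchyDensity f hw1]
    have e : Real.pi⁻¹ * (‖w⁻¹ * deriv f w‖ * (1 - ‖w‖ ^ 2)) * (1 - ‖w‖)⁻¹ =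
        (1 + ‖w‖) * Real.pi⁻¹ * ‖w⁻¹ * deriv f w‖ := by
      field_simp
      ring
    rw [e]
    gcongr
    linarith

theorem integral_cauchyDensity_mul_diskKernel_sq {f : ℂ → ℂ} (hf : AnalyticOnNhd ℂ f (ball 0 1))
    {z : ℂ} (hz : ‖z‖ < 1)
    (hI : IntegrableOn (fun w => ‖cauchyDensity f w‖ * ‖diskKernel z w‖ ^ 2) (ball 0 1 \ {0})) :
    ∫ w in ball 0 1 \ {0}, cauchyDensity f w * diskKernel z w ^ 2 = f z - f 0 := by
  have hS : MeasurableSet (ball (0 : ℂ) 1 \ {0}) :=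
    measurableSet_ball.diff (measurableSet_singleton 0)
  have hpi : (Real.pi : ℂ) ≠ 0 := by exact_mod_cast Real.pi_ne_zero
  have h1 := integrableOn_mul_diskKernel_mul hS (continuousOn_cauchyDensity hf) hI hI
  rw [integrableOn_congr_set_ae ball_sdiff_zero_ae_eq] at h1
  have e (w : ℂ) : cauchyDensity f w * diskKernel z w ^ 2 =
      (Real.pi : ℂ)⁻¹ * ((conj w)⁻¹ * deriv f w * (1 - ‖w‖ ^ 2 : ℝ) * diskKernel z w ^ 2) := by
    rw [cauchyDensity, mul_assoc]
  have h2 : IntegrableOn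
      (fun w => (conj w)⁻¹ * deriv f w * (1 - ‖w‖ ^ 2 : ℝ) * diskKernel z w ^ 2) (ball 0 1) := by
    refine IntegrableOn.congr_fun (h1.const_mul (Real.pi : ℂ)) (fun w _ => ?_) measurableSet_ball
    rw [← sq, e, mul_inv_cancel_left₀ hpi]
  rw [setIntegral_congr_set ball_sdiff_zero_ae_eq]
  simp_rw [e]
  rw [integral_const_mul, integral_deriv_mul_diskKernel_sq hf hz h2, inv_mul_cancel_left₀ hpi]

theorem mainTheorem12 (f : ℂ → ℂ) (hf : AnalyticOnNhd ℂ f (ball 0 1))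
    (hμ : DensityMemCMs fun ζ => ζ⁻¹ * deriv f ζ) :
    ∃ F : ℂ → ℂ, EqOn F f (ball 0 1) ∧
      (∀ ζ ∈ sphere (0 : ℂ) 1, HasBoundaryValue f ζ (F ζ)) ∧
      IsCLDeriv.{u} F ∧
      clDerivNorm.{u} (fun z => F z - F 0) ≤ 2 * densityCMsNorm fun ζ => ζ⁻¹ * deriv f ζ := by
  have hS : MeasurableSet (ball (0 : ℂ) 1 \ {0}) :=
    measurableSet_ball.diff (measurableSet_singleton 0)
  have hSb : (ball (0 : ℂ) 1 \ {0} : Set ℂ) ⊆ ball 0 1 := sdiff_subset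
  -- Taking the exact supremum serves two purposes: the gliding hump argument makes it finite, and
  -- comparison with the Carleson norm gives the sharp factor `2π`, which an arbitrary bound would
  -- lose.
  set B : ℝ≥0∞ := ⨆ z ∈ closedBall (0 : ℂ) 1,
    poissonBalayage (densityVariation fun ζ => ζ⁻¹ * deriv f ζ) z with hB
  have hBtop : B ≠ ∞ := by
    obtain ⟨C, hC⟩ := hμ.exists_poissonBalayage_le
    exact ((iSup₂_le hC).trans_lt ENNReal.coe_lt_top).ne
  lift B to ℝ≥0 using hBtop with K hKB
  have hK : ∀ z ∈ closedBall (0 : ℂ) 1,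
      poissonBalayage (densityVariation fun ζ => ζ⁻¹ * deriv f ζ) z ≤ K := fun z hz => by
    rw [hB]
    exact le_iSup₂_of_le z hz le_rfl
  have hfin : ∀ z ∈ closedBall (0 : ℂ) 1,
      poissonBalayage (densityVariation fun ζ => ζ⁻¹ * deriv f ζ) z < ∞ :=
    fun z hz => (hK z hz).trans_lt ENNReal.coe_lt_top
  have hnorm {z : ℂ} (hz : z ∈ closedBall (0 : ℂ) 1) : ‖z‖ ≤ 1 := by simpa using hz
  have hφ := continuousOn_cauchyDensity hf
  have hI : ∀ z ∈ closedBall (0 : ℂ) 1, IntegrableOn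
      (fun w => ‖cauchyDensity f w‖ * ‖diskKernel z w‖ ^ 2) (ball 0 1 \ {0}) :=
    fun z hz => integrableOn_cauchyDensity_mul hf (hnorm hz) (hfin z hz)
  have hle : ∀ z ∈ closedBall (0 : ℂ) 1,
      ∫ w in ball 0 1 \ {0}, ‖cauchyDensity f w‖ * ‖diskKernel z w‖ ^ 2 ≤ Real.pi⁻¹ * K :=
    fun z hz => integral_cauchyDensity_mul_le hf (hnorm hz) (hK z hz)
  have hint := integrableOn_cauchyDensity_div hf (hfin 0 (by simp))
  set G : ℂ → ℂ := fun z => ∫ w in ball 0 1 \ {0}, cauchyDensity f w * diskKernel z w ^ 2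
  set g : ℂ → ℂ := fun z => ∫ w in ball 0 1 \ {0}, cauchyDensity f w * (z * diskKernel z w)
  have hG : EqOn (fun z => G z + f 0) f (ball 0 1) := fun z hz => by
    have := integral_cauchyDensity_mul_diskKernel_sq hf (mem_ball_zero_iff.1 hz)
      (hI z (ball_subset_closedBall hz))
    exact eq_add_of_sub_eq this.symm |>.symm
  have hd : ∀ z ∈ closedBall (0 : ℂ) 1, HasDerivWithinAt g (G z) (closedBall 0 1) z :=
    fun z hz => hasDerivWithinAt_integral_diskKernel hS hSb hφ hint hI hle hz
  have hgc : ContinuousOn g (closedBall 0 1) := fun z hz => (hd z hz).continuousWithinAt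
  have hbd : CommutatorBound.{u} (closedBall 0 1) g (Real.toNNReal (Real.pi⁻¹ * K)) := by
    intro H _ _ _ N R hN hs
    rw [Real.coe_toNNReal _ (by positivity)]
    exact norm_commutator_cfc_integral_diskKernel_le hN hs hS hSb hφ hint hI hle R
  have hprim : IsCLPrimitive.{u} g G := ⟨⟨hgc, _, hbd⟩, hd⟩
  refine ⟨fun z => G z + f 0, hG, fun ζ hζ => ?_, ⟨_, hprim.add_const_mul (f 0)⟩, ?_⟩
  · have hζ' := sphere_subset_closedBall hζ
    have hbv := hasBoundaryValue_integral_diskKernel_sq hS hSb hφ (hnorm hζ') (hI ζ hζ')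
    exact HasBoundaryValue.congr (fun M => (hbv M).add_const (f 0)) hG
  -- The reproducing formula at `z = 0` shows that `G` itself is `F - F 0`, so the primitive `g`
  -- needs no linear correction in the norm estimate.
  · have h0 : G 0 = 0 := by simpa using hG (mem_ball_self one_pos)
    have hFG : (fun z => G z + f 0 - (G 0 + f 0)) = G := by
      funext z
      rw [h0]
      ring
    rw [hFG, clDerivNorm_eq hprim]
    refine (iInf₂_le (Real.toNNReal (Real.pi⁻¹ * K)) ⟨hgc, hbd⟩).trans ?_
    have hK2 : (K : ℝ≥0∞) ≤ ENNReal.ofReal (2 * Real.pi) *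
        densityCMsNorm fun ζ => ζ⁻¹ * deriv f ζ := by
      rw [hB]
      exact iSup₂_le fun z hz => poissonBalayage_le_strongCarlesonNorm _ (hnorm hz)
    calc ((Real.toNNReal (Real.pi⁻¹ * K) : ℝ≥0) : ℝ≥0∞) = ENNReal.ofReal Real.pi⁻¹ * K := by
          rw [← ENNReal.ofReal_coe_nnreal (p := K), ← ENNReal.ofReal_mul (by positivity)]
          rfl
      _ ≤ ENNReal.ofReal Real.pi⁻¹ * (ENNReal.ofReal (2 * Real.pi) *
            densityCMsNorm fun ζ => ζ⁻¹ * deriv f ζ) := by gcongr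
      _ = _ := by
          rw [← mul_assoc, ← ENNReal.ofReal_mul (by positivity), mul_comm 2 Real.pi,
            inv_mul_cancel_left₀ Real.pi_ne_zero, ENNReal.ofReal_ofNat]

end MainTheorem
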